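/- Let $G$ be a connected solvable real Lie group, let $\Gamma\subset G$ be a discrete subgroup such that $M:=\Gamma\backslash G$ is compact, with $\dim_{\mathbb R}M=4n$, and let $(I,J,K)$ be an invariant hypercomplex structure on $M$, i.e. three (integrable) complex structures on $M$ which anticommute with each other, satisfy $IJ=K$, and are induced by left-invariant complex structures on $G$. Let $\nabla$ be the Obata connection of $(M,I,J,K)$, i.e. the torsion-free connection on $TM$ with $\nabla I=\nabla J=\nabla K=0$. Then the following are equivalent: (1) the holonomy of $\nabla$ is contained in $\mathrm{SL}(n,\mathbb{H})$, i.e. for every $x\in M$ the parallel transport of $\nabla$ along every piecewise smooth loop based at $x$ is a quaternion-linear automorphism of $T_xM\cong\mathbb{H}^n$ which lies in $\mathrm{SL}(n,\mathbb{H})$ (its real determinant, equivalently its Dieudonné determinant, is $1$); (2) the canonical bundle of $(M,I)$ admits an invariant nowhere vanishing holomorphic section, i.e. there is a nowhere vanishing smooth complex-valued form $\eta$ of type $(2n,0)$ with respect to $I$ such that $\bar\partial\eta=0$ and such that the pullback of $\eta$ to $G$ is left-invariant. -/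

import Mathlib

open Set Topology Bundle
open scoped Manifold ContDiff

/-! ### The quotient manifold of left translation orbits -/

/-- The space `Γ \ G` of orbits of `Γ` acting on `G` by left translations, with the quotient
topology. -/
abbrev LeftQuotient {G : Type*} [Group G] (Γ : Subgroup G) : Type _ :=
  Quotient (QuotientGroup.rightRel Γ)

namespace LeftQuotient

section

variable {G : Type*} [Group G]

/-- The projection `G → Γ \ G`. -/
def proj (Γ : Subgroup G) (g : G) : LeftQuotient Γ := Quotient.mk (QuotientGroup.rightRel Γ) g

theorem proj_surjective (Γ : Subgroup G) : Function.Surjective (proj Γ) := Quotient.mk_surjective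

theorem proj_eq_iff (Γ : Subgroup G) {g h : G} : proj Γ g = proj Γ h ↔ h * g⁻¹ ∈ Γ :=
  Quotient.eq.trans QuotientGroup.rightRel_apply

theorem proj_isLocalHomeomorph [TopologicalSpace G] [IsTopologicalGroup G] (Γ : Subgroup G)
    [DiscreteTopology Γ] : IsLocalHomeomorph (proj Γ) :=
  (Topology.IsQuotientMap.isQuotientCoveringMap_of_subgroup (f := proj Γ)
    isQuotientMap_quotient_mk' Γ
    (isDiscrete_iff_discreteTopology.2 inferInstance)
    (proj_eq_iff Γ)).isCoveringMap.isLocalHomeomorph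

end

variable {E : Type*} [NormedAddCommGroup E] [NormedSpace ℝ E]
  {G : Type*} [TopologicalSpace G] [ChartedSpace E G] [Group G] [LieGroup 𝓘(ℝ, E) ∞ G]
  (Γ : Subgroup G) [DiscreteTopology Γ]

/-- The charts of `Γ \ G` are the charts of `G` composed with local inverses of the projection. -/
noncomputable instance instChartedSpace : ChartedSpace E (LeftQuotient Γ) :=
  have : IsTopologicalGroup G := topologicalGroup_of_lieGroup 𝓘(ℝ, E) ∞
  (proj_isLocalHomeomorph Γ).chartedSpace (proj_surjective Γ)

instance instIsManifold : IsManifold 𝓘(ℝ, E) ∞ (LeftQuotient Γ) := by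
  have : IsTopologicalGroup G := topologicalGroup_of_lieGroup 𝓘(ℝ, E) ∞
  apply isManifold_of_contDiffOn
  rintro e e' ⟨q, rfl⟩ ⟨q', rfl⟩
  have hl := proj_isLocalHomeomorph Γ
  generalize (proj_surjective Γ).hasRightInverse.choose q = a
  generalize (proj_surjective Γ).hasRightInverse.choose q' = b
  intro y hy
  simp only [modelWithCornersSelf_coe, modelWithCornersSelf_coe_symm, Function.comp_id,
    Function.id_comp, preimage_id, range_id, inter_univ, OpenPartialHomeomorph.trans_source,
    OpenPartialHomeomorph.coe_trans, OpenPartialHomeomorph.symm_source,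
    OpenPartialHomeomorph.trans_target, OpenPartialHomeomorph.coe_trans_symm, mem_inter_iff,
    mem_preimage, Function.comp_apply, hl.localInverseAt_symm] at hy ⊢
  obtain ⟨⟨hy1, -⟩, hy2, hy3⟩ := hy
  set z := (chartAt E a).symm y with hz
  set z' := hl.localInverseAt b (proj Γ z) with hz'
  have hzz' : proj Γ z' = proj Γ z := hl.apply_localInverseAt_of_mem hy2
  set γ : G := z' * z⁻¹ with hγ
  have hγΓ : γ ∈ Γ := (proj_eq_iff Γ).1 hzz'.symm
  have hγz : γ * z = z' := by simp [hγ]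
  have hproj (w : G) : proj Γ (γ * w) = proj Γ w := ((proj_eq_iff Γ).2 (by simpa using hγΓ)).symm
  have hmem : z' ∈ (hl.localInverseAt b).target := (hl.localInverseAt b).map_source hy2
  -- near `z` the deck transformation is left translation by `γ`
  have hev : ∀ᶠ w in 𝓝 z, hl.localInverseAt b (proj Γ w) = γ * w := by
    have hcont : Filter.Tendsto (fun w => γ * w) (𝓝 z) (𝓝 z') := by
      rw [← hγz]; exact (continuous_const_mul γ).tendsto z
    filter_upwards [hcont ((hl.localInverseAt b).open_target.mem_nhds hmem)] with w hw
    have h1 := (hl.localInverseAt b).right_inv hw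
    rwa [hl.localInverseAt_symm, hproj] at h1
  have hc : ContMDiffAt 𝓘(ℝ, E) 𝓘(ℝ, E) ∞ (chartAt E a).symm y :=
    (contMDiffOn_chart_symm (I := 𝓘(ℝ, E)) y hy1).contMDiffAt
      ((chartAt E a).open_target.mem_nhds hy1)
  have hm : ContMDiffAt 𝓘(ℝ, E) 𝓘(ℝ, E) ∞ (fun w => γ * w) z := contMDiff_mul_left.contMDiffAt
  have hc' : ContMDiffAt 𝓘(ℝ, E) 𝓘(ℝ, E) ∞ (chartAt E b) (γ * z) := by
    rw [hγz]
    exact (contMDiffOn_chart (I := 𝓘(ℝ, E)) z' hy3).contMDiffAt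
      ((chartAt E b).open_source.mem_nhds hy3)
  have hcomp : ContMDiffAt 𝓘(ℝ, E) 𝓘(ℝ, E) ∞
      (fun x => chartAt E b (γ * (chartAt E a).symm x)) y :=
    ContMDiffAt.comp y (g := chartAt E b) (f := fun x => γ * (chartAt E a).symm x) hc'
      (ContMDiffAt.comp y (g := fun w => γ * w) hm hc)
  refine (hcomp.contDiffAt.congr_of_eventuallyEq ?_).contDiffWithinAt
  filter_upwards [hc.continuousAt.eventually hev] with x hx
  simp only [Function.comp_apply]
  rw [hx]

end LeftQuotient

/-! ### Hypercomplex manifolds and the Obata connection -/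

section Manifold

variable (E : Type*) [NormedAddCommGroup E] [NormedSpace ℝ E]
  (M : Type*) [TopologicalSpace M] [ChartedSpace E M] [IsManifold 𝓘(ℝ, E) ∞ M]

/-- A complex structure on a manifold: a smooth field `A` of endomorphisms of the tangent spaces
with `A² = -1` whose Nijenhuis tensor
`N(X, Y) = [X, Y] + A[AX, Y] + A[X, AY] - [AX, AY]` vanishes. -/
structure ComplexStructure where
  toFun : ∀ x : M, TangentSpace 𝓘(ℝ, E) x →L[ℝ] TangentSpace 𝓘(ℝ, E) x
  smooth : ContMDiff 𝓘(ℝ, E) (𝓘(ℝ, E).prod 𝓘(ℝ, E →L[ℝ] E)) ∞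
    (fun x => TotalSpace.mk' (E →L[ℝ] E)
      (E := fun x : M => TangentSpace 𝓘(ℝ, E) x →L[ℝ] TangentSpace 𝓘(ℝ, E) x) x (toFun x))
  sq : ∀ x v, toFun x (toFun x v) = -v
  integrable : ∀ (X Y : ∀ x : M, TangentSpace 𝓘(ℝ, E) x) (x : M),
    MDiffAt (T% X) x → MDiffAt (T% Y) x →
    VectorField.mlieBracket 𝓘(ℝ, E) X Y x
      + toFun x (VectorField.mlieBracket 𝓘(ℝ, E) (fun y => toFun y (X y)) Y x)
      + toFun x (VectorField.mlieBracket 𝓘(ℝ, E) X (fun y => toFun y (Y y)) x)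
      - VectorField.mlieBracket 𝓘(ℝ, E) (fun y => toFun y (X y)) (fun y => toFun y (Y y)) x = 0

instance : CoeFun (ComplexStructure E M)
    (fun _ => ∀ x : M, TangentSpace 𝓘(ℝ, E) x →L[ℝ] TangentSpace 𝓘(ℝ, E) x) :=
  ⟨ComplexStructure.toFun⟩

/-- A hypercomplex structure: three complex structures which anticommute with each other, with
`I J = K`. -/
structure HypercomplexStructure where
  I : ComplexStructure E M
  J : ComplexStructure E M
  K : ComplexStructure E M
  I_J : ∀ x v, I x (J x v) = K x v
  J_I : ∀ x v, J x (I x v) = -I x (J x v)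
  K_J : ∀ x v, K x (J x v) = -J x (K x v)
  K_I : ∀ x v, K x (I x v) = -I x (K x v)

end Manifold

section Obata

variable {E : Type*} [NormedAddCommGroup E] [NormedSpace ℝ E]
  {M : Type*} [TopologicalSpace M] [ChartedSpace E M] [IsManifold 𝓘(ℝ, E) ∞ M]

theorem ComplexStructure.mdiffAt (A : ComplexStructure E M)
    {X : ∀ x : M, TangentSpace 𝓘(ℝ, E) x} {x : M} (hX : MDiffAt (T% X) x) :
    MDiffAt (T% (fun y => A y (X y))) x :=
  MDifferentiableAt.clm_bundle_apply (A.smooth.mdifferentiable (by simp) x) hX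

namespace HypercomplexStructure

variable (H : HypercomplexStructure E M)

theorem J_K (x : M) (v : TangentSpace 𝓘(ℝ, E) x) : H.J x (H.K x v) = H.I x v := by
  rw [← H.I_J, H.J_I, H.J.sq, map_neg, neg_neg]

theorem K_I_eq (x : M) (v : TangentSpace 𝓘(ℝ, E) x) : H.K x (H.I x v) = H.J x v := by
  rw [H.K_I, ← H.I_J, H.I.sq, neg_neg]

theorem K_J_eq (x : M) (v : TangentSpace 𝓘(ℝ, E) x) : H.K x (H.J x v) = -H.I x v := by
  rw [H.K_J, H.J_K]

/-- A connection `∇` on the tangent bundle is an Obata connection if it is torsion-free and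
`∇I = ∇J = ∇K = 0`. Recall that `cov Y x v` stands for `(∇_v Y)(x)`. -/
structure IsObata [FiniteDimensional ℝ E]
    (cov : CovariantDerivative 𝓘(ℝ, E) E (TangentSpace 𝓘(ℝ, E) : M → Type _)) : Prop where
  torsion_eq_zero : haveI := FiniteDimensional.complete ℝ E; cov.torsion = 0
  parallel_I : ∀ (Y : ∀ x : M, TangentSpace 𝓘(ℝ, E) x) (x : M), MDiffAt (T% Y) x →
    ∀ v, cov (fun y => H.I y (Y y)) x v = H.I x (cov Y x v)
  parallel_J : ∀ (Y : ∀ x : M, TangentSpace 𝓘(ℝ, E) x) (x : M), MDiffAt (T% Y) x →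
    ∀ v, cov (fun y => H.J y (Y y)) x v = H.J x (cov Y x v)
  parallel_K : ∀ (Y : ∀ x : M, TangentSpace 𝓘(ℝ, E) x) (x : M), MDiffAt (T% Y) x →
    ∀ v, cov (fun y => H.K y (Y y)) x v = H.K x (cov Y x v)

/-- The expression `½ ([X, Y] + I[IX, Y] - J[X, JY] + K[IX, JY])`. -/
noncomputable def obataAux (X Y : ∀ x : M, TangentSpace 𝓘(ℝ, E) x) (x : M) :
    TangentSpace 𝓘(ℝ, E) x :=
  (1 / 2 : ℝ) • (VectorField.mlieBracket 𝓘(ℝ, E) X Y x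
    + H.I x (VectorField.mlieBracket 𝓘(ℝ, E) (fun y => H.I y (X y)) Y x)
    - H.J x (VectorField.mlieBracket 𝓘(ℝ, E) X (fun y => H.J y (Y y)) x)
    + H.K x (VectorField.mlieBracket 𝓘(ℝ, E) (fun y => H.I y (X y)) (fun y => H.J y (Y y)) x))

theorem tensorialAt_obataAux [FiniteDimensional ℝ E] (Y : ∀ x : M, TangentSpace 𝓘(ℝ, E) x)
    (x : M) : TensorialAt 𝓘(ℝ, E) E (fun X => H.obataAux X Y x) x where
  smul {f X} hf hX := by
    have := FiniteDimensional.complete ℝ E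
    have hI : (fun y => H.I y ((f • X) y)) = f • (fun y => H.I y (X y)) := by
      ext y; simp
    have hIX := H.I.mdiffAt hX
    simp only [obataAux]
    rw [hI, VectorField.mlieBracket_smul_left hf hX, VectorField.mlieBracket_smul_left hf hIX,
      VectorField.mlieBracket_smul_left hf hX, VectorField.mlieBracket_smul_left hf hIX]
    simp only [map_add, map_smul, H.I.sq, H.K_I_eq]
    module
  add {X X'} hX hX' := by
    have := FiniteDimensional.complete ℝ E
    have hI : (fun y => H.I y ((X + X') y))
        = (fun y => H.I y (X y)) + (fun y => H.I y (X' y)) := by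
      ext y; simp
    have hIX := H.I.mdiffAt hX
    have hIX' := H.I.mdiffAt hX'
    simp only [obataAux]
    rw [hI, VectorField.mlieBracket_add_left hX hX', VectorField.mlieBracket_add_left hIX hIX',
      VectorField.mlieBracket_add_left hX hX', VectorField.mlieBracket_add_left hIX hIX']
    simp only [map_add]
    module

/-- The Obata connection of a hypercomplex structure,
`∇_X Y = ½ ([X, Y] + I[IX, Y] - J[X, JY] + K[IX, JY])`. -/
noncomputable def obata [FiniteDimensional ℝ E] :
    CovariantDerivative 𝓘(ℝ, E) E (TangentSpace 𝓘(ℝ, E) : M → Type _) where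
  toFun Y x := TensorialAt.mkHom (fun X => H.obataAux X Y x) x (H.tensorialAt_obataAux Y x)
  isCovariantDerivativeOnUniv := by
    have := FiniteDimensional.complete ℝ E
    constructor
    · intro Y Y' x hY hY' _
      ext v
      have hJ : (fun y => H.J y ((Y + Y') y))
          = (fun y => H.J y (Y y)) + (fun y => H.J y (Y' y)) := by
        ext y; simp
      have hJY := H.J.mdiffAt hY
      have hJY' := H.J.mdiffAt hY'
      simp only [add_apply]
      simp only [TensorialAt.mkHom_apply_eq_extend, obataAux]
      rw [hJ, VectorField.mlieBracket_add_right hY hY', VectorField.mlieBracket_add_right hY hY',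
        VectorField.mlieBracket_add_right hJY hJY', VectorField.mlieBracket_add_right hJY hJY']
      simp only [map_add]
      module
    · intro Y f x hY hf _
      ext v
      have hJ : (fun y => H.J y ((f • Y) y)) = f • (fun y => H.J y (Y y)) := by
        ext y; simp
      have hJY := H.J.mdiffAt hY
      simp only [add_apply, smul_apply,
        ContinuousLinearMap.smulRight_apply]
      simp only [TensorialAt.mkHom_apply_eq_extend, obataAux]
      rw [hJ, VectorField.mlieBracket_smul_right hf hY, VectorField.mlieBracket_smul_right hf hY,
        VectorField.mlieBracket_smul_right hf hJY, VectorField.mlieBracket_smul_right hf hJY]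
      simp only [map_add, map_smul, H.J.sq, H.K_J_eq, FiberBundle.extend_apply_self]
      module

theorem obata_apply [FiniteDimensional ℝ E] {X : ∀ x : M, TangentSpace 𝓘(ℝ, E) x} {x : M}
    (hX : MDiffAt (T% X) x) (Y : ∀ x : M, TangentSpace 𝓘(ℝ, E) x) :
    H.obata Y x (X x) = H.obataAux X Y x :=
  TensorialAt.mkHom_apply (H.tensorialAt_obataAux Y x) hX

theorem obata_J [FiniteDimensional ℝ E] (Y : ∀ x : M, TangentSpace 𝓘(ℝ, E) x) (x : M)
    (_hY : MDiffAt (T% Y) x) (v : TangentSpace 𝓘(ℝ, E) x) :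
    H.obata (fun y => H.J y (Y y)) x v = H.J x (H.obata Y x v) := by
  have := FiniteDimensional.complete ℝ E
  obtain ⟨X, hX, rfl⟩ : ∃ X : ∀ x : M, TangentSpace 𝓘(ℝ, E) x, MDiffAt (T% X) x ∧ X x = v :=
    ⟨FiberBundle.extend E v, FiberBundle.mdifferentiableAt_extend .., FiberBundle.extend_apply_self ..⟩
  rw [H.obata_apply hX, H.obata_apply hX]
  simp only [obataAux]
  have hneg (Z : ∀ x : M, TangentSpace 𝓘(ℝ, E) x) :
      VectorField.mlieBracket 𝓘(ℝ, E) Z (fun y => H.J y (H.J y (Y y))) x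
        = -VectorField.mlieBracket 𝓘(ℝ, E) Z Y x := by
    have e : (fun y => H.J y (H.J y (Y y))) = (-1 : ℝ) • Y := by
      ext y; simp [H.J.sq]
    rw [e, VectorField.mlieBracket_const_smul_right _hY, neg_one_smul]
  rw [hneg, hneg]
  simp only [map_add, map_sub, map_smul, map_neg, H.J.sq, H.J_I, ← H.I_J]
  module

theorem obata_I [FiniteDimensional ℝ E] (Y : ∀ x : M, TangentSpace 𝓘(ℝ, E) x) (x : M)
    (hY : MDiffAt (T% Y) x) (v : TangentSpace 𝓘(ℝ, E) x) :
    H.obata (fun y => H.I y (Y y)) x v = H.I x (H.obata Y x v) := by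
  have := FiniteDimensional.complete ℝ E
  obtain ⟨X, hX, rfl⟩ : ∃ X : ∀ x : M, TangentSpace 𝓘(ℝ, E) x, MDiffAt (T% X) x ∧ X x = v :=
    ⟨FiberBundle.extend E v, FiberBundle.mdifferentiableAt_extend .., FiberBundle.extend_apply_self ..⟩
  rw [H.obata_apply hX, H.obata_apply hX]
  simp only [obataAux]
  have h1 := congrArg (H.I x) (H.I.integrable X Y x hX hY)
  have h2 := congrArg (H.K x) (H.I.integrable X _ x hX (H.J.mdiffAt hY))
  have hneg (Z : ∀ x : M, TangentSpace 𝓘(ℝ, E) x) :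
      VectorField.mlieBracket 𝓘(ℝ, E) Z (fun y => H.J y (H.I y (Y y))) x
        = -VectorField.mlieBracket 𝓘(ℝ, E) Z (fun y => H.I y (H.J y (Y y))) x := by
    have e : (fun y => H.J y (H.I y (Y y))) = (-1 : ℝ) • (fun y => H.I y (H.J y (Y y))) := by
      ext y; simp [H.J_I]
    rw [e, VectorField.mlieBracket_const_smul_right (H.I.mdiffAt (H.J.mdiffAt hY)), neg_one_smul]
  rw [hneg, hneg]
  have hIK (w : TangentSpace 𝓘(ℝ, E) x) : H.I x (H.K x w) = -H.J x w := by
    rw [← H.I_J, H.I.sq]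
  simp only [map_add, map_sub, map_smul, map_neg, map_zero, H.I.sq, H.K_I_eq] at h1 h2 ⊢
  simp only [hIK, H.I_J] at h2 ⊢
  linear_combination (norm := module) (-(1 / 2) : ℝ) • (h1 - h2)

/-- The connection `H.obata` is torsion-free and preserves the hypercomplex structure. -/
theorem isObata_obata [FiniteDimensional ℝ E] : H.IsObata H.obata where
  torsion_eq_zero := by
    have := FiniteDimensional.complete ℝ E
    rw [CovariantDerivative.torsion_eq_zero_iff]
    intro X Y x hX hY
    rw [H.obata_apply hX, H.obata_apply hY]
    have h1 := H.I.integrable X Y x hX hY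
    have h2 := H.J.integrable X Y x hX hY
    have h3 := H.K.integrable _ _ x (H.I.mdiffAt hX) (H.I.mdiffAt hY)
    simp only [H.K_I_eq] at h3
    simp only [obataAux]
    rw [VectorField.mlieBracket_swap_apply (V := Y) (W := X),
      VectorField.mlieBracket_swap_apply (V := fun y => H.I y (Y y)) (W := X),
      VectorField.mlieBracket_swap_apply (V := Y) (W := fun y => H.J y (X y)),
      VectorField.mlieBracket_swap_apply (V := fun y => H.I y (Y y))
        (W := fun y => H.J y (X y))]
    simp only [map_neg]
    linear_combination (norm := module) (1 / 2 : ℝ) • (h1 - h2 + h3)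
  parallel_I Y x hY v := H.obata_I Y x hY v
  parallel_J Y x hY v := H.obata_J Y x hY v
  parallel_K Y x hY v := by
    simp only [← H.I_J]
    rw [H.obata_I _ x (H.J.mdiffAt hY), H.obata_J Y x hY]

end HypercomplexStructure

end Obata

/-! ### Parallel transport and holonomy -/

section Holonomy

variable {E : Type*} [NormedAddCommGroup E] [NormedSpace ℝ E]
  {M : Type*} [TopologicalSpace M] [ChartedSpace E M] [IsManifold 𝓘(ℝ, E) ∞ M]

/-- The field `V` along the curve `c` is differentiable at time `t`, with covariant derivative `D`.
In the frame of coordinate fields `∂ᵢ` of the preferred chart at `c t`, the field reads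
`V s = ∑ Vⁱ(s) ∂ᵢ`, and `D = ∑ (Vⁱ)'(t) ∂ᵢ + ∇_{c'(t)} (∑ Vⁱ(t) ∂ᵢ)`; the field
`∑ Vⁱ(t) ∂ᵢ` with constant coefficients is `FiberBundle.extend E (V t)`. -/
def HasCovDerivAlong
    (cov : CovariantDerivative 𝓘(ℝ, E) E (TangentSpace 𝓘(ℝ, E) : M → Type _))
    (c : ℝ → M) (V : ∀ t, TangentSpace 𝓘(ℝ, E) (c t)) (t : ℝ)
    (D : TangentSpace 𝓘(ℝ, E) (c t)) : Prop :=
  ∃ w : E,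
    HasDerivAt (fun s => (trivializationAt E (TangentSpace 𝓘(ℝ, E) : M → Type _) (c t)
      ⟨c s, V s⟩).2) w t ∧
    D = (trivializationAt E (TangentSpace 𝓘(ℝ, E) : M → Type _) (c t)).symm (c t) w
      + cov (FiberBundle.extend E (x := c t) (V t)) (c t)
        (mfderiv 𝓘(ℝ, ℝ) 𝓘(ℝ, E) c t (1 : ℝ))

/-- `IsParallelTransport cov P` says that `P : T_x M → T_y M` is the parallel transport of the
connection `cov` along some piecewise smooth path from `x` to `y`: a finite concatenation of
smooth curves, each parametrized by `[0, 1]`. -/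
inductive IsParallelTransport
    (cov : CovariantDerivative 𝓘(ℝ, E) E (TangentSpace 𝓘(ℝ, E) : M → Type _)) :
    ∀ {x y : M}, (TangentSpace 𝓘(ℝ, E) x ≃ₗ[ℝ] TangentSpace 𝓘(ℝ, E) y) → Prop
  | smooth (c : ℝ → M) (hc : ContMDiff 𝓘(ℝ, ℝ) 𝓘(ℝ, E) ∞ c)
      (P : TangentSpace 𝓘(ℝ, E) (c 0) ≃ₗ[ℝ] TangentSpace 𝓘(ℝ, E) (c 1))
      (hP : ∀ v, ∃ V : ∀ t, TangentSpace 𝓘(ℝ, E) (c t),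
        (∀ t ∈ Icc (0 : ℝ) 1, HasCovDerivAlong cov c V t 0) ∧ V 0 = v ∧ V 1 = P v) :
      IsParallelTransport cov P
  | trans {x y z : M} (P : TangentSpace 𝓘(ℝ, E) x ≃ₗ[ℝ] TangentSpace 𝓘(ℝ, E) y)
      (Q : TangentSpace 𝓘(ℝ, E) y ≃ₗ[ℝ] TangentSpace 𝓘(ℝ, E) z)
      (hP : IsParallelTransport cov P) (hQ : IsParallelTransport cov Q) :
      IsParallelTransport cov (P.trans Q)

/-- The holonomy group at `x`: the group of parallel transports along piecewise smooth loops
based at `x`. -/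
noncomputable def holonomyGroup
    (cov : CovariantDerivative 𝓘(ℝ, E) E (TangentSpace 𝓘(ℝ, E) : M → Type _)) (x : M) :
    Subgroup (TangentSpace 𝓘(ℝ, E) x ≃ₗ[ℝ] TangentSpace 𝓘(ℝ, E) x) :=
  Subgroup.closure {P | IsParallelTransport cov P}

/-- The group `SL(n, ℍ)` of the quaternionic vector space `T_x M ≅ ℍⁿ`: the quaternion-linear
automorphisms with determinant one. The real determinant of a quaternion-linear automorphism is the
fourth power of its (positive) Dieudonné determinant, so that `SL(n, ℍ)` is cut out by either. -/
noncomputable def HypercomplexStructure.SL (H : HypercomplexStructure E M) (x : M) :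
    Subgroup (TangentSpace 𝓘(ℝ, E) x ≃ₗ[ℝ] TangentSpace 𝓘(ℝ, E) x) where
  carrier := {P | (∀ v, P (H.I x v) = H.I x (P v)) ∧ (∀ v, P (H.J x v) = H.J x (P v)) ∧
    (∀ v, P (H.K x v) = H.K x (P v)) ∧ LinearEquiv.det P = 1}
  mul_mem' := by
    rintro P Q ⟨hI, hJ, hK, hd⟩ ⟨hI', hJ', hK', hd'⟩
    exact ⟨fun v => by simp [hI, hI'], fun v => by simp [hJ, hJ'], fun v => by simp [hK, hK'],
      by rw [map_mul, hd, hd', one_mul]⟩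
  one_mem' := ⟨fun _ => rfl, fun _ => rfl, fun _ => rfl, map_one _⟩
  inv_mem' := by
    rintro P ⟨hI, hJ, hK, hd⟩
    have key (A : TangentSpace 𝓘(ℝ, E) x →L[ℝ] TangentSpace 𝓘(ℝ, E) x)
        (h : ∀ v, P (A v) = A (P v)) (v) : P.symm (A v) = A (P.symm v) := by
      rw [LinearEquiv.symm_apply_eq, h, LinearEquiv.apply_symm_apply]
    exact ⟨key _ hI, key _ hJ, key _ hK, by rw [map_inv, hd, inv_one]⟩

end Holonomy

/-! ### Complex-valued forms and the canonical bundle -/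

section Forms

variable (E : Type*) [NormedAddCommGroup E] [NormedSpace ℝ E]
  {M : Type*} [TopologicalSpace M] [ChartedSpace E M] [IsManifold 𝓘(ℝ, E) ∞ M]

/-- Complex-valued differential `k`-forms on `M` (not necessarily smooth). -/
abbrev ComplexForm (M : Type*) [TopologicalSpace M] [ChartedSpace E M] (k : ℕ) : Type _ :=
  ∀ x : M, TangentSpace 𝓘(ℝ, E) x [⋀^Fin k]→L[ℝ] ℂ

variable {E}

namespace ComplexForm

/-- The pullback of a form to the model space under the inverse of the preferred chart at `x`. -/
noncomputable def inChart {k : ℕ} (η : ComplexForm E M k) (x : M) (y : E) : E [⋀^Fin k]→L[ℝ] ℂ :=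
  (η ((extChartAt 𝓘(ℝ, E) x).symm y)).compContinuousLinearMap
    (mfderiv 𝓘(ℝ, E) 𝓘(ℝ, E) (extChartAt 𝓘(ℝ, E) x).symm y)

/-- A form is smooth if it is smooth in the charts. -/
def IsSmooth {k : ℕ} (η : ComplexForm E M k) : Prop :=
  ∀ x : M, ContDiffOn ℝ ∞ (η.inChart x) (extChartAt 𝓘(ℝ, E) x).target

/-- The exterior derivative, computed at `x` in the preferred chart at `x`. -/
noncomputable def d {k : ℕ} (η : ComplexForm E M k) : ComplexForm E M (k + 1) := fun x =>
  (extDeriv (η.inChart x) (extChartAt 𝓘(ℝ, E) x x)).compContinuousLinearMap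
    (mfderiv 𝓘(ℝ, E) 𝓘(ℝ, E) (extChartAt 𝓘(ℝ, E) x) x)

/-- A `k`-form has type `(k, 0)` with respect to the complex structure `A` if it is complex linear
in each argument. -/
def IsTypeZero {k : ℕ} (A : ComplexStructure E M) (η : ComplexForm E M k) : Prop :=
  ∀ (x : M) (v : Fin k → TangentSpace 𝓘(ℝ, E) x) (j : Fin k),
    η x (Function.update v j (A x (v j))) = Complex.I * η x v

/-- A holomorphic `k`-form: a smooth form `η` of type `(k, 0)` with `∂̄η = 0`. As `dη` only has
components of types `(k + 1, 0)` and `(k, 1)`, namely `∂η` and `∂̄η`, the latter condition says that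
`dη` has type `(k + 1, 0)`. -/
structure IsHolomorphic {k : ℕ} (A : ComplexStructure E M) (η : ComplexForm E M k) : Prop where
  smooth : η.IsSmooth
  type_zero : η.IsTypeZero A
  dbar_eq_zero : η.d.IsTypeZero A

end ComplexForm

end Forms

/-! ### Invariant objects on `Γ \ G` -/

namespace LeftQuotient

variable {E : Type*} [NormedAddCommGroup E] [NormedSpace ℝ E]
  {G : Type*} [TopologicalSpace G] [ChartedSpace E G] [Group G] [LieGroup 𝓘(ℝ, E) ∞ G]
  (Γ : Subgroup G) [DiscreteTopology Γ]

/-- The image at `Γ g` of the left-invariant vector field of `G` with value `v` at `1`. -/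
noncomputable def invariantVector (v : GroupLieAlgebra 𝓘(ℝ, E) G) (g : G) :
    TangentSpace 𝓘(ℝ, E) (proj Γ g) :=
  mfderiv 𝓘(ℝ, E) 𝓘(ℝ, E) (proj Γ) g (mulInvariantVectorField v g)

variable {Γ}

/-- A complex structure on `Γ \ G` is invariant if it is induced by a left-invariant one on `G`,
that is, if it has constant coefficients on left-invariant vector fields. -/
def IsInvariantStructure (A : ComplexStructure E (LeftQuotient Γ)) : Prop :=
  ∃ a : GroupLieAlgebra 𝓘(ℝ, E) G →L[ℝ] GroupLieAlgebra 𝓘(ℝ, E) G,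
    ∀ (g : G) (v : GroupLieAlgebra 𝓘(ℝ, E) G),
      A (proj Γ g) (invariantVector Γ v g) = invariantVector Γ (a v) g

/-- A hypercomplex structure on `Γ \ G` is invariant if its three complex structures are. -/
def IsInvariantHypercomplex (H : HypercomplexStructure E (LeftQuotient Γ)) : Prop :=
  IsInvariantStructure H.I ∧ IsInvariantStructure H.J ∧ IsInvariantStructure H.K

/-- A form on `Γ \ G` is invariant if its pullback to `G` is left-invariant, that is, if it has
constant coefficients on left-invariant vector fields. -/
def IsInvariantForm {k : ℕ} (η : ComplexForm E (LeftQuotient Γ) k) : Prop :=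
  ∃ α : GroupLieAlgebra 𝓘(ℝ, E) G [⋀^Fin k]→L[ℝ] ℂ,
    ∀ (g : G) (v : Fin k → GroupLieAlgebra 𝓘(ℝ, E) G),
      η (proj Γ g) (fun i => invariantVector Γ (v i) g) = α v

end LeftQuotient

/-! ### Traces and alternating maps -/

/-! In the frame of left-invariant fields the Obata connection has constant coefficients, because
its defining formula involves only Lie brackets and the structures `I`, `J`, `K`. It is thus given
by a linear map `conn` from the Lie algebra to its endomorphisms. Let `τ v` be the real trace of
`conn v` (`traceForm`). Both conditions are equivalent to `τ = 0`.

Holomorphic side. Each `conn v` commutes with `i` and `j`, and `j` anticommutes with `i`, so its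
complex trace is real and equals `τ v / 2` (`AlternatingMap.sum_update_eq_half_trace_mul`). As the
connection is torsion-free, the exterior derivative is the alternation of the covariant derivative
(`FormHasCoeff.d_apply`). An invariant form `η` of type `(2n, 0)` therefore satisfies `dη = -(τ/2) ∧
η`. If `τ = 0`, then `dη = 0`. Conversely, if `dη` is complex linear in each argument and `η` does
not vanish, then the real form `τ` is itself complex linear, hence zero.

Holonomy side. Parallel transport in the frame solves `u' = -conn (velocity) u`. It commutes with
`i`, `j`, `k` by uniqueness of solutions, and by Liouville's formula its determinant is the
exponential of `-∫ τ`. So `τ = 0` puts the holonomy in `SL`. Conversely, if all loops have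
determinant one, then `-τ` is the differential of a function `f`, built from logarithms of
determinants (`exists_potential`). On a compact manifold `f` has a maximum, where `τ` must vanish;
since `τ` has constant coefficients in the frame, it vanishes everywhere
(`ConstantFrame.traceForm_eq_zero`). -/

/-- By Cramer's rule each summand is a diagonal entry of `V.adjugate * (N * V)`; cyclicity of the
trace and `V * V.adjugate = det V` give the rest. This is the infinitesimal form of multiplicativity
of the determinant. -/
theorem Matrix.sum_det_updateCol_mulVec {R ι : Type*} [CommRing R] [Fintype ι] [DecidableEq ι]
    (N V : Matrix ι ι R) :
    ∑ j, (V.updateCol j (N.mulVec (V.col j))).det = N.trace * V.det := by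
  have h (j : ι) : (V.updateCol j (N.mulVec (V.col j))).det = (V.adjugate * (N * V)) j j := by
    rw [← Matrix.cramer_apply, Matrix.cramer_eq_adjugate_mulVec, Matrix.mul_apply]
    rfl
  simp only [h]
  change (V.adjugate * (N * V)).trace = _
  rw [Matrix.trace_mul_comm, Matrix.mul_assoc, Matrix.mul_adjugate]
  simp [mul_comm]

/-- Alternating maps of top degree are multiples of the determinant of a basis, so the matrix
identity applies. It is used over `ℂ` for the canonical bundle and over `ℝ` for Liouville's formula.
-/
theorem AlternatingMap.sum_update_eq_trace_mul {K W ι : Type*} [Field K] [AddCommGroup W]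
    [Module K W] [Fintype ι] [DecidableEq ι] (e : Module.Basis ι K W) (α : W [⋀^ι]→ₗ[K] K)
    (N : W →ₗ[K] W) (v : ι → W) :
    ∑ j, α (Function.update v j (N (v j))) = LinearMap.trace K W N * α v := by
  have h := Matrix.sum_det_updateCol_mulVec (LinearMap.toMatrix e e N) (e.toMatrix v)
  rw [α.eq_smul_basis_det e]
  simp only [AlternatingMap.smul_apply, smul_eq_mul, ← Finset.mul_sum, Module.Basis.det_apply]
  rw [LinearMap.trace_eq_matrix_trace K e, mul_left_comm, ← h]
  congr 1
  refine Finset.sum_congr rfl fun j _ => ?_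
  rw [Module.Basis.toMatrix_update]
  congr 2
  ext k
  rw [← LinearMap.toMatrix_mulVec_repr e e]
  rfl

/-- In the real basis consisting of the `c k` and `I • c k`, each complex diagonal entry contributes
its real part twice. -/
theorem LinearMap.trace_restrictScalars_complex {W : Type*} [AddCommGroup W] [Module ℂ W]
    [Module ℝ W] [IsScalarTower ℝ ℂ W] [FiniteDimensional ℂ W] (f : W →ₗ[ℂ] W) :
    LinearMap.trace ℝ W (f.restrictScalars ℝ) = 2 * (LinearMap.trace ℂ W f).re := by
  let c := Module.finBasis ℂ W
  rw [LinearMap.trace_eq_matrix_trace ℝ (Complex.basisOneI.smulTower c),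
    LinearMap.trace_eq_matrix_trace ℂ c]
  simp only [Matrix.trace, Matrix.diag, LinearMap.toMatrix_apply, Fintype.sum_prod_type,
    Module.Basis.smulTower_apply, Module.Basis.smulTower_repr, LinearMap.coe_restrictScalars,
    map_smul, Fin.sum_univ_two]
  simp [Complex.re_sum, two_mul]

/-- Conjugation by `j` fixes `f` and negates `i`, so the trace equals its own negative. -/
theorem LinearMap.trace_comp_eq_zero_of_anticommute {V : Type*} [AddCommGroup V] [Module ℝ V]
    [FiniteDimensional ℝ V] {f i j : V →ₗ[ℝ] V} (hj : ∀ v, j (j v) = -v) (hij : ∀ v, j (i v) = -i (j v))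
    (hf : ∀ v, f (j v) = j (f v)) : LinearMap.trace ℝ V (f ∘ₗ i) = 0 := by
  have h : f ∘ₗ i = j ∘ₗ (f ∘ₗ i ∘ₗ j) := by
    ext v
    simp [← hf, hij, hj]
  have h' : LinearMap.trace ℝ V (f ∘ₗ i) = -LinearMap.trace ℝ V (f ∘ₗ i) := by
    conv_lhs => rw [h, LinearMap.trace_comp_comm']
    rw [← map_neg]
    congr 1
    ext v
    simp [hj]
  linarith

/-! ### Alternating forms that are complex linear for an endomorphism of square `-1` -/

section ComplexStructure

variable {V : Type*} [AddCommGroup V] [Module ℝ V] (i : V →ₗ[ℝ] V) (hi : ∀ v, i (i v) = -v)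

/-- The complex vector space structure given by an endomorphism of square `-1`. -/
abbrev Module.ofSqEqNegOne : Module ℂ V :=
  Module.compHom V (Complex.liftAux (A := Module.End ℝ V) i
    (LinearMap.ext fun v => by simpa using hi v)).toRingHom

theorem Module.ofSqEqNegOne_smul (z : ℂ) (v : V) :
    letI := Module.ofSqEqNegOne i hi
    z • v = z.re • v + z.im • i v := by
  have h : (i : Module.End ℝ V) * i = -1 := LinearMap.ext fun v => by simpa using hi v
  change Complex.liftAux (A := Module.End ℝ V) i h z v = _
  simp [Complex.liftAux_apply, Algebra.algebraMap_eq_smul_one]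

theorem Module.ofSqEqNegOne_isScalarTower :
    letI := Module.ofSqEqNegOne i hi
    IsScalarTower ℝ ℂ V :=
  letI := Module.ofSqEqNegOne i hi
  ⟨fun r z v => by simp [Module.ofSqEqNegOne_smul, smul_smul, smul_add]⟩

variable {i}

/-- A complex linear endomorphism commuting with a quaternionic structure acts on complex
alternating forms of top degree by half its real trace. -/
theorem AlternatingMap.sum_update_eq_half_trace_mul [FiniteDimensional ℝ V] {n : ℕ}
    (hi : ∀ v, i (i v) = -v)
    (hV : Module.finrank ℝ V = 2 * n) {j N : V →ₗ[ℝ] V} (hj : ∀ v, j (j v) = -v)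
    (hij : ∀ v, j (i v) = -i (j v)) (hNi : ∀ v, N (i v) = i (N v)) (hNj : ∀ v, N (j v) = j (N v))
    (α : V [⋀^Fin n]→ₗ[ℝ] ℂ)
    (hα : ∀ v k, α (Function.update v k (i (v k))) = Complex.I * α v) (v : Fin n → V) :
    ∑ k, α (Function.update v k (N (v k))) = ((LinearMap.trace ℝ V N / 2 : ℝ) : ℂ) * α v := by
  let := Module.ofSqEqNegOne i hi
  have := Module.ofSqEqNegOne_isScalarTower i hi
  have hsmul := Module.ofSqEqNegOne_smul i hi
  have : FiniteDimensional ℂ V := Module.Finite.of_restrictScalars_finite ℝ ℂ V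
  have hVC : Module.finrank ℂ V = n := by
    have := Module.finrank_mul_finrank ℝ ℂ V
    rw [Complex.finrank_real_complex] at this
    omega
  let NC : V →ₗ[ℂ] V :=
    { N with map_smul' := fun z v => by simp [hsmul, hNi] }
  let iC : V →ₗ[ℂ] V :=
    { i with map_smul' := fun z v => by simp [hsmul] }
  let αC : V [⋀^Fin n]→ₗ[ℂ] ℂ :=
    { α with
      map_update_add' := fun m k x y => by
        convert! α.map_update_add m k x y
      map_update_smul' := @fun inst m k z x => by
        obtain rfl : inst = instDecidableEqFin n := Subsingleton.elim _ _
        have h := hα (Function.update m k x) k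
        simp only [Function.update_self, Function.update_idem] at h
        have h2 : α (Function.update m k (z • x)) = z • α (Function.update m k x) := by
          rw [hsmul, α.map_update_add, α.map_update_smul, α.map_update_smul, h]
          conv_rhs => rw [← Complex.re_add_im z]
          simp only [Complex.real_smul, smul_eq_mul]
          ring
        exact h2 }
  have key := AlternatingMap.sum_update_eq_trace_mul (Module.finBasisOfFinrankEq ℂ V hVC) αC NC v
  have h1 := LinearMap.trace_restrictScalars_complex NC
  -- `NC ∘ₗ iC` is `Complex.I • NC`, so its real trace is minus twice the imaginary part of the
  -- complex trace of `NC`. It vanishes by the anticommutation with `j`; hence the complex trace is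
  -- real.
  have h2 := LinearMap.trace_restrictScalars_complex (NC ∘ₗ iC)
  have h3 : LinearMap.trace ℝ V ((NC ∘ₗ iC).restrictScalars ℝ) = 0 :=
    LinearMap.trace_comp_eq_zero_of_anticommute (f := N) hj hij hNj
  have h4 : NC ∘ₗ iC = Complex.I • NC := by
    ext v
    change N (i v) = Complex.I • N v
    rw [hNi, hsmul]
    simp
  rw [h3, h4, map_smul] at h2
  have h5 : LinearMap.trace ℂ V NC = ((LinearMap.trace ℝ V N / 2 : ℝ) : ℂ) := by
    apply Complex.ext
    · simp only [Complex.ofReal_re]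
      have : LinearMap.trace ℝ V (NC.restrictScalars ℝ) = LinearMap.trace ℝ V N := rfl
      linarith
    · simp at h2 ⊢
      linarith
  rw [← h5]
  exact key

end ComplexStructure

/-- The witness is the determinant of a complex basis, regarded as a real multilinear map. -/
theorem ContinuousAlternatingMap.exists_ne_zero_of_complexStructure {V : Type*}
    [NormedAddCommGroup V] [NormedSpace ℝ V] [FiniteDimensional ℝ V] {n : ℕ}
    (hV : Module.finrank ℝ V = 2 * n) {i : V →ₗ[ℝ] V} (hi : ∀ v, i (i v) = -v) :
    ∃ α : V [⋀^Fin n]→L[ℝ] ℂ, α ≠ 0 ∧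
      ∀ v k, α (Function.update v k (i (v k))) = Complex.I * α v := by
  let := Module.ofSqEqNegOne i hi
  have := Module.ofSqEqNegOne_isScalarTower i hi
  have hsmul := Module.ofSqEqNegOne_smul i hi
  have : FiniteDimensional ℂ V := Module.Finite.of_restrictScalars_finite ℝ ℂ V
  have hVC : Module.finrank ℂ V = n := by
    have := Module.finrank_mul_finrank ℝ ℂ V
    rw [Complex.finrank_real_complex] at this
    omega
  let e := Module.finBasisOfFinrankEq ℂ V hVC
  have hcont : Continuous fun v : Fin n → V => e.det v := by
    simp only [Module.Basis.det_apply]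
    refine Continuous.matrix_det (continuous_matrix fun a b => ?_)
    have h := ((e.coord a).restrictScalars ℝ).continuous_of_finiteDimensional
    exact h.comp (continuous_apply b)
  refine ⟨{ toFun := fun v => e.det v
            cont := hcont
            map_update_add' := fun m k x y => by
              convert! e.det.map_update_add m k x y
            map_update_smul' := fun m k r x => by
              have h := e.det.map_update_smul m k (r : ℂ) x
              have hr : (r : ℂ) • x = r • x := by simp [hsmul]
              rw [hr] at h
              convert! h
            map_eq_zero_of_eq' := e.det.map_eq_zero_of_eq' }, ?_, ?_⟩
  · intro h
    have h1 : e.det e = 0 := congrArg (fun α : V [⋀^Fin n]→L[ℝ] ℂ => α e) h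
    rw [e.det_self] at h1
    exact one_ne_zero h1
  · intro v k
    have h := e.det.map_update_smul v k Complex.I (v k)
    rw [Function.update_eq_self, hsmul, Complex.I_re, Complex.I_im, zero_smul, one_smul,
      zero_add] at h
    exact h

/-! ### Frames in which a connection has constant coefficients -/

section ConstantFrame

variable {E : Type*} [NormedAddCommGroup E] [NormedSpace ℝ E]
  {M : Type*} [TopologicalSpace M] [ChartedSpace E M] [IsManifold 𝓘(ℝ, E) ∞ M]

/-- A smooth global frame in which the connection `cov` has constant coefficients. -/
structure ConstantFrame (V : Type*) [NormedAddCommGroup V] [NormedSpace ℝ V]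
    (cov : CovariantDerivative 𝓘(ℝ, E) E (TangentSpace 𝓘(ℝ, E) : M → Type _)) where
  frame : ∀ x : M, V ≃L[ℝ] TangentSpace 𝓘(ℝ, E) x
  contMDiff : ∀ v : V, ContMDiff 𝓘(ℝ, E) 𝓘(ℝ, E).tangent ∞ (T% (fun x : M => frame x v))
  conn : V →L[ℝ] V →L[ℝ] V
  cov_frame : ∀ (v w : V) (x : M), cov (fun y => frame y w) x (frame x v) = frame x (conn v w)

namespace ConstantFrame

variable {V : Type*} [NormedAddCommGroup V] [NormedSpace ℝ V]
  {cov : CovariantDerivative 𝓘(ℝ, E) E (TangentSpace 𝓘(ℝ, E) : M → Type _)}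
  (Φ : ConstantFrame V cov)

/-- The frame read in the preferred chart at `x`. -/
noncomputable def inChart (x : M) (z : E) : V →L[ℝ] E :=
  (mfderiv 𝓘(ℝ, E) 𝓘(ℝ, E) (extChartAt 𝓘(ℝ, E) x) ((extChartAt 𝓘(ℝ, E) x).symm z)).comp
    (Φ.frame ((extChartAt 𝓘(ℝ, E) x).symm z)).toContinuousLinearMap

/-- The coframe read in the preferred chart at `x`. -/
noncomputable def inChartInv (x : M) (z : E) : E →L[ℝ] V :=
  (Φ.frame ((extChartAt 𝓘(ℝ, E) x).symm z)).symm.toContinuousLinearMap.comp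
    (mfderiv 𝓘(ℝ, E) 𝓘(ℝ, E) (extChartAt 𝓘(ℝ, E) x).symm z)

/-- Links the derivative of the chart, convenient for calculus, with the trivialization that occurs
in `HasCovDerivAlong` and `FiberBundle.extend`. -/
theorem inChart_apply (x : M) {y : M} (hy : y ∈ (extChartAt 𝓘(ℝ, E) x).source) (v : V) :
    Φ.inChart x (extChartAt 𝓘(ℝ, E) x y) v
      = (trivializationAt E (TangentSpace 𝓘(ℝ, E) : M → Type _) x ⟨y, Φ.frame y v⟩).2 := by
  rw [extChartAt_source] at hy
  have h := TangentBundle.continuousLinearMapAt_trivializationAt (I := 𝓘(ℝ, E)) (𝕜 := ℝ) hy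
  have hy' : y ∈ (extChartAt 𝓘(ℝ, E) x).source := by rwa [extChartAt_source]
  rw [← Trivialization.continuousLinearMapAt_apply_of_mem ℝ]
  · rw [h]
    simp only [inChart]
    rw [(extChartAt 𝓘(ℝ, E) x).left_inv hy']
    rfl
  · simpa using hy

theorem inChartInv_inChart (x : M) {z : E} (hz : z ∈ (extChartAt 𝓘(ℝ, E) x).target) (v : V) :
    Φ.inChartInv x z (Φ.inChart x z v) = v := by
  have h := DFunLike.congr_fun
    (mfderivWithin_extChartAt_symm_comp_mfderiv_extChartAt (I := 𝓘(ℝ, E)) hz)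
    (Φ.frame ((extChartAt 𝓘(ℝ, E) x).symm z) v)
  rw [modelWithCornersSelf_coe, range_id, mfderivWithin_univ] at h
  exact (congrArg (Φ.frame ((extChartAt 𝓘(ℝ, E) x).symm z)).symm h).trans
    ((Φ.frame ((extChartAt 𝓘(ℝ, E) x).symm z)).symm_apply_apply v)

theorem inChart_inChartInv (x : M) {z : E} (hz : z ∈ (extChartAt 𝓘(ℝ, E) x).target) (v : E) :
    Φ.inChart x z (Φ.inChartInv x z v) = v := by
  have h := DFunLike.congr_fun
    (mfderiv_extChartAt_comp_mfderivWithin_extChartAt_symm (I := 𝓘(ℝ, E)) hz) v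
  rw [modelWithCornersSelf_coe, range_id, mfderivWithin_univ] at h
  refine Eq.trans ?_ h
  exact congrArg (mfderiv 𝓘(ℝ, E) 𝓘(ℝ, E) (extChartAt 𝓘(ℝ, E) x) _)
    ((Φ.frame ((extChartAt 𝓘(ℝ, E) x).symm z)).apply_symm_apply _)

/-- The frame read in the preferred chart at `x`, as an equivalence. -/
noncomputable def inChartEquiv (x : M) {z : E} (hz : z ∈ (extChartAt 𝓘(ℝ, E) x).target) :
    V ≃L[ℝ] E :=
  ContinuousLinearEquiv.equivOfInverse (Φ.inChart x z) (Φ.inChartInv x z)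
    (Φ.inChartInv_inChart x hz) (Φ.inChart_inChartInv x hz)

theorem contDiffOn_inChart [FiniteDimensional ℝ V] (x : M) :
    ContDiffOn ℝ ∞ (Φ.inChart x) (extChartAt 𝓘(ℝ, E) x).target := by
  rw [contDiffOn_clm_apply]
  intro v
  have h := (Trivialization.contMDiffOn_section_baseSet_iff
    (e := trivializationAt E (TangentSpace 𝓘(ℝ, E) : M → Type _) x)).1 (Φ.contMDiff v).contMDiffOn
  have h2 := h.comp (contMDiffOn_extChartAt_symm x) (fun z hz => by
    simpa using (extChartAt 𝓘(ℝ, E) x).map_target hz)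
  rw [← contMDiffOn_iff_contDiffOn]
  refine h2.congr fun z hz => ?_
  have := Φ.inChart_apply x ((extChartAt 𝓘(ℝ, E) x).map_target hz) v
  rw [(extChartAt 𝓘(ℝ, E) x).right_inv hz] at this
  exact this

theorem contDiffOn_inChartInv [FiniteDimensional ℝ V] (x : M) :
    ContDiffOn ℝ ∞ (Φ.inChartInv x) (extChartAt 𝓘(ℝ, E) x).target := by
  have := FiniteDimensional.complete ℝ V
  intro z hz
  have h := (contDiffAt_map_inverse (𝕜 := ℝ) (n := ∞)
    (Φ.inChartEquiv x hz)).comp_contDiffWithinAt z (Φ.contDiffOn_inChart x z hz)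
  -- The coframe is the pointwise inverse of the frame, and inversion of continuous linear maps is
  -- smooth at invertible ones.
  have hinv {z : E} (hz : z ∈ (extChartAt 𝓘(ℝ, E) x).target) :
      Φ.inChartInv x z = (Φ.inChart x z).inverse :=
    (ContinuousLinearMap.inverse_equiv (Φ.inChartEquiv x hz)).symm
  exact h.congr (fun z hz => hinv hz) (hinv hz)

theorem inChart_self (x : M) (v : V) :
    Φ.inChart x (extChartAt 𝓘(ℝ, E) x x) v = Φ.frame x v := by
  have h := mfderiv_extChartAt_self (I := 𝓘(ℝ, E)) (x := x)
  simp only [inChart]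
  rw [(extChartAt 𝓘(ℝ, E) x).left_inv (mem_extChartAt_source x), h]
  rfl

theorem inChartInv_self (x : M) (v : TangentSpace 𝓘(ℝ, E) x) :
    Φ.inChartInv x (extChartAt 𝓘(ℝ, E) x x) v = (Φ.frame x).symm v := by
  have h := Φ.inChartInv_inChart x (mem_extChartAt_target (I := 𝓘(ℝ, E)) x) ((Φ.frame x).symm v)
  rw [Φ.inChart_self, ContinuousLinearEquiv.apply_symm_apply] at h
  exact h

theorem mdifferentiableAt (x : M) (v : V) : MDiffAt (T% (fun x : M => Φ.frame x v)) x :=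
  (Φ.contMDiff v).mdifferentiable (by simp) x

/-- Coordinate fields written in the frame: this is what allows covariant derivatives of the fields
`FiberBundle.extend` to be computed from `conn`. -/
theorem extend_eq (x : M) (v : TangentSpace 𝓘(ℝ, E) x) {y : M}
    (hy : y ∈ (extChartAt 𝓘(ℝ, E) x).source) :
    FiberBundle.extend E v y
      = Φ.frame y (Φ.inChartInv x (extChartAt 𝓘(ℝ, E) x y) v) := by
  have hs : x ∈ (trivializationAt E (TangentSpace 𝓘(ℝ, E) : M → Type _) x).baseSet :=
    FiberBundle.mem_baseSet_trivializationAt' x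
  have h := (Φ.inChart_inChartInv x ((extChartAt 𝓘(ℝ, E) x).map_source hy) v).symm.trans
    (Φ.inChart_apply x hy (Φ.inChartInv x (extChartAt 𝓘(ℝ, E) x y) v))
  have h' := Φ.inChart_apply x (mem_extChartAt_source x) ((Φ.frame x).symm v)
  rw [Φ.inChart_self, ContinuousLinearEquiv.apply_symm_apply] at h'
  have hy' : y ∈ (trivializationAt E (TangentSpace 𝓘(ℝ, E) : M → Type _) x).baseSet := by
    simpa using hy
  simp only [FiberBundle.extend]
  exact (congrArg _ (h'.symm.trans h)).trans (Trivialization.symm_apply_apply_mk _ hy' _)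

theorem _root_.CovariantDerivative.map_sum {ι : Type*} (s : Finset ι)
    (cov : CovariantDerivative 𝓘(ℝ, E) E (TangentSpace 𝓘(ℝ, E) : M → Type _))
    {σ : ι → ∀ x : M, TangentSpace 𝓘(ℝ, E) x} {x : M} (hσ : ∀ i, MDiffAt (T% (σ i)) x) :
    cov (∑ i ∈ s, σ i) x = ∑ i ∈ s, cov (σ i) x := by
  classical
  induction s using Finset.induction_on with
  | empty => simp
  | insert a s ha ih =>
    rw [Finset.sum_insert ha, Finset.sum_insert ha, ← ih]
    refine cov.isCovariantDerivativeOnUniv.add (hσ a) ?_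
    have := MDifferentiableAt.sum_section (s := s) fun i _ => hσ i
    convert! this using 3
    simp

/-- Expanding `h` in a basis of `V` reduces this to the Leibniz rule for a function times a frame
field. -/
theorem cov_frame_apply [FiniteDimensional ℝ V] {h : M → V} {x : M}
    (hh : MDifferentiableAt 𝓘(ℝ, E) 𝓘(ℝ, V) h x) (w : TangentSpace 𝓘(ℝ, E) x) :
    cov (fun y => Φ.frame y (h y)) x w
      = Φ.frame x (Φ.conn ((Φ.frame x).symm w) (h x) + mvfderiv 𝓘(ℝ, E) h x w) := by
  let b := Module.finBasis ℝ V
  let l (i) : V →L[ℝ] ℝ := (b.coord i).toContinuousLinearMap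
  have hl (v : V) : v = ∑ i, l i v • b i := (b.sum_repr v).symm
  have hlm (i) : MDifferentiableAt 𝓘(ℝ, E) 𝓘(ℝ, ℝ) (fun y => l i (h y)) x :=
    (l i).differentiableAt.mdifferentiableAt.comp x hh
  have hld (i) : mvfderiv 𝓘(ℝ, E) (fun y => l i (h y)) x w = l i (mvfderiv 𝓘(ℝ, E) h x w) :=
    (mvfderiv_comp_apply (I' := 𝓘(ℝ, E)) (I := 𝓘(ℝ, V)) (g := l i) x
      (l i).differentiableAt.mdifferentiableAt hh w).trans
      (DFunLike.congr_fun (mfderiv_eq_fderiv.trans (l i).fderiv) _)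
  have hsum : (fun y => Φ.frame y (h y))
      = ∑ i, ((fun y => l i (h y)) • fun y => Φ.frame y (b i)) := by
    ext y
    conv_lhs => rw [hl (h y)]
    simp
  rw [hsum, CovariantDerivative.map_sum _ _
    fun i => (hlm i).smul_section (Φ.mdifferentiableAt x (b i))]
  have hterm (i) : cov ((fun y => l i (h y)) • fun y => Φ.frame y (b i)) x w
      = Φ.frame x (l i (h x) • Φ.conn ((Φ.frame x).symm w) (b i)
        + l i (mvfderiv 𝓘(ℝ, E) h x w) • b i) := by
    rw [cov.isCovariantDerivativeOnUniv.leibniz (Φ.mdifferentiableAt x (b i)) (hlm i)]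
    have := Φ.cov_frame ((Φ.frame x).symm w) (b i) x
    rw [ContinuousLinearEquiv.apply_symm_apply] at this
    simp [this, hld]
  rw [sum_apply]
  simp only [hterm]
  rw [← map_sum, Finset.sum_add_distrib, ← hl]
  conv_rhs => rw [hl (h x)]
  simp

end ConstantFrame
end ConstantFrame

theorem hasDerivAt_extChartAt_comp {E : Type*} [NormedAddCommGroup E] [NormedSpace ℝ E]
    {M : Type*} [TopologicalSpace M] [ChartedSpace E M] {c : ℝ → M} {t : ℝ}
    (hc : MDifferentiableAt 𝓘(ℝ, ℝ) 𝓘(ℝ, E) c t) :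
    HasDerivAt (fun s => extChartAt 𝓘(ℝ, E) (c t) (c s))
      (mfderiv 𝓘(ℝ, ℝ) 𝓘(ℝ, E) c t (1 : ℝ) : E) t := by
  let L : ℝ →L[ℝ] E := mfderiv 𝓘(ℝ, ℝ) 𝓘(ℝ, E) c t
  have h : HasFDerivWithinAt (fun s => extChartAt 𝓘(ℝ, E) (c t) (c s)) L (range 𝓘(ℝ, ℝ)) t := hc.hasMFDerivAt.2
  rw [modelWithCornersSelf_coe, range_id, hasFDerivWithinAt_univ] at h
  exact h.hasDerivAt

/-! ### Covariant derivatives of coordinate fields and of fields along curves -/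

section ConstantFrame

variable {E : Type*} [NormedAddCommGroup E] [NormedSpace ℝ E]
  {M : Type*} [TopologicalSpace M] [ChartedSpace E M] [IsManifold 𝓘(ℝ, E) ∞ M]

namespace ConstantFrame

variable {V : Type*} [NormedAddCommGroup V] [NormedSpace ℝ V]
  {cov : CovariantDerivative 𝓘(ℝ, E) E (TangentSpace 𝓘(ℝ, E) : M → Type _)}
  (Φ : ConstantFrame V cov)

theorem hasFDerivAt_inChartInv [FiniteDimensional ℝ V] (x : M) {z : E}
    (hz : z ∈ (extChartAt 𝓘(ℝ, E) x).target) :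
    HasFDerivAt (Φ.inChartInv x) (fderiv ℝ (Φ.inChartInv x) z) z :=
  (((Φ.contDiffOn_inChartInv x z hz).contDiffAt
    ((isOpen_extChartAt_target x).mem_nhds hz)).differentiableAt (by simp)).hasFDerivAt

/-- The Christoffel symbols of the chart: the frame coefficients of a coordinate field are the
values of the coframe, whose derivative supplies the second term. -/
theorem cov_extend [FiniteDimensional ℝ V] (x : M) (v w : TangentSpace 𝓘(ℝ, E) x) :
    cov (FiberBundle.extend E v) x w
      = Φ.frame x (Φ.conn ((Φ.frame x).symm w) ((Φ.frame x).symm v)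
        + fderiv ℝ (Φ.inChartInv x) (extChartAt 𝓘(ℝ, E) x x) w v) := by
  let φ := extChartAt 𝓘(ℝ, E) x
  let v' : E := v
  let h : M → V := fun y => Φ.inChartInv x (φ y) v'
  have hB : HasFDerivAt (fun z => Φ.inChartInv x z v')
      ((ContinuousLinearMap.apply ℝ V v').comp (fderiv ℝ (Φ.inChartInv x) (φ x))) (φ x) :=
    (ContinuousLinearMap.apply ℝ V v').hasFDerivAt.comp (φ x)
      (Φ.hasFDerivAt_inChartInv x (mem_extChartAt_target (I := 𝓘(ℝ, E)) x))
  have hφ : MDifferentiableAt 𝓘(ℝ, E) 𝓘(ℝ, E) φ x := mdifferentiableAt_extChartAt (by simp)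
  have hh : MDifferentiableAt 𝓘(ℝ, E) 𝓘(ℝ, V) h x :=
    (hB.differentiableAt.mdifferentiableAt).comp x hφ
  have hd : mvfderiv 𝓘(ℝ, E) h x w = fderiv ℝ (Φ.inChartInv x) (φ x) w v' := by
    refine (mfderiv_comp_apply x (hB.differentiableAt.mdifferentiableAt) hφ w).trans ?_
    have h1 : mfderiv 𝓘(ℝ, E) 𝓘(ℝ, E) φ x w = w :=
      DFunLike.congr_fun (mfderiv_extChartAt_self (I := 𝓘(ℝ, E)) (x := x)) w
    exact (congrArg _ h1).trans (DFunLike.congr_fun (mfderiv_eq_fderiv.trans hB.fderiv) _)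
  have hev : ∀ᶠ y in 𝓝 x, FiberBundle.extend E v y = Φ.frame y (h y) := by
    filter_upwards [extChartAt_source_mem_nhds (I := 𝓘(ℝ, E)) x] with y hy
    exact Φ.extend_eq x v hy
  have hext : MDiffAt (T% (FiberBundle.extend E v : ∀ y : M, TangentSpace 𝓘(ℝ, E) y)) x :=
    FiberBundle.mdifferentiableAt_extend ..
  have hfr : MDiffAt (T% (fun y : M => Φ.frame y (h y))) x := by
    refine hext.congr_of_eventuallyEq ?_
    filter_upwards [hev] with y hy
    rw [hy]
  rw [cov.isCovariantDerivativeOnUniv.congr_of_eventuallyEq hext hfr Filter.univ_mem hev,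
    Φ.cov_frame_apply hh, hd]
  congr 3
  exact Φ.inChartInv_self x v

/-- The velocity of a curve, read in the frame. -/
noncomputable def velocity (c : ℝ → M) (t : ℝ) : V :=
  (Φ.frame (c t)).symm (mfderiv 𝓘(ℝ, ℝ) 𝓘(ℝ, E) c t (1 : ℝ))

/-- The frame coefficients `u` and the chart coefficients `g` are related by `u = B g`, with `B` the
coframe along the curve. The product rule gives `u' = B' g + B g'`, and `B' g` is exactly the extra
term of `cov_extend`. Parallel transport thereby becomes a linear equation in the fixed space `V`.
-/
theorem hasCovDerivAlong_iff [FiniteDimensional ℝ V] {c : ℝ → M} {t : ℝ}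
    (hc : MDifferentiableAt 𝓘(ℝ, ℝ) 𝓘(ℝ, E) c t) (U : ∀ t, TangentSpace 𝓘(ℝ, E) (c t))
    (D : TangentSpace 𝓘(ℝ, E) (c t)) :
    HasCovDerivAlong cov c U t D ↔ ∃ u' : V,
      HasDerivAt (fun s => (Φ.frame (c s)).symm (U s)) u' t ∧
      D = Φ.frame (c t) (u' + Φ.conn (Φ.velocity c t) ((Φ.frame (c t)).symm (U t))) := by
  set x := c t with hx
  obtain ⟨c', hc'⟩ : ∃ c' : E, c' = mfderiv 𝓘(ℝ, ℝ) 𝓘(ℝ, E) c t (1 : ℝ) := ⟨_, rfl⟩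
  have hct := hasDerivAt_extChartAt_comp hc
  rw [← hc'] at hct
  set ct : ℝ → E := fun s => extChartAt 𝓘(ℝ, E) x (c s) with hct_def
  set u : ℝ → V := fun s => (Φ.frame (c s)).symm (U s) with hu
  set g : ℝ → E := fun s => (trivializationAt E (TangentSpace 𝓘(ℝ, E) : M → Type _) x
    ⟨c s, U s⟩).2 with hg
  have hsrc : ∀ᶠ s in 𝓝 t, c s ∈ (extChartAt 𝓘(ℝ, E) x).source :=
    hc.continuousAt.eventually (extChartAt_source_mem_nhds (I := 𝓘(ℝ, E)) x)
  have hgu : ∀ᶠ s in 𝓝 t, g s = Φ.inChart x (ct s) (u s) := by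
    filter_upwards [hsrc] with s hs
    have := Φ.inChart_apply x hs (u s)
    simp only [hu, ContinuousLinearEquiv.apply_symm_apply] at this
    exact this.symm
  have hug : ∀ᶠ s in 𝓝 t, u s = Φ.inChartInv x (ct s) (g s) := by
    filter_upwards [hsrc, hgu] with s hs h
    rw [h, Φ.inChartInv_inChart x ((extChartAt 𝓘(ℝ, E) x).map_source hs)]
  have hgt : g t = U t := by
    rw [hgu.self_of_nhds]
    exact (Φ.inChart_self x (u t)).trans ((Φ.frame x).apply_symm_apply (U t))
  have hB := (Φ.hasFDerivAt_inChartInv x (mem_extChartAt_target (I := 𝓘(ℝ, E)) x)).comp_hasDerivAt t hct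
  have hF : DifferentiableAt ℝ (fun s => Φ.inChart x (ct s)) t :=
    (((Φ.contDiffOn_inChart x _ (mem_extChartAt_target (I := 𝓘(ℝ, E)) x)).contDiffAt
      ((isOpen_extChartAt_target x).mem_nhds (mem_extChartAt_target (I := 𝓘(ℝ, E)) x))).differentiableAt
      (by simp)).comp (f := ct) t hct.differentiableAt
  have key (w : E) (hw : HasDerivAt g w t) :
      ∃ u' : V, HasDerivAt u u' t ∧
        (trivializationAt E (TangentSpace 𝓘(ℝ, E) : M → Type _) x).symm x w
          + cov (FiberBundle.extend E (x := x) (U t)) x (mfderiv 𝓘(ℝ, ℝ) 𝓘(ℝ, E) c t (1 : ℝ))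
        = Φ.frame x (u' + Φ.conn (Φ.velocity c t) ((Φ.frame x).symm (U t))) := by
    refine ⟨_, (hB.clm_apply hw).congr_of_eventuallyEq hug, ?_⟩
    rw [Φ.cov_extend x]
    have h1 : (trivializationAt E (TangentSpace 𝓘(ℝ, E) : M → Type _) x).symm x w
        = Φ.frame x (Φ.inChartInv x (ct t) w) := by
      have hx' : x ∈ (trivializationAt E (TangentSpace 𝓘(ℝ, E) : M → Type _) x).baseSet :=
        FiberBundle.mem_baseSet_trivializationAt' x
      have h2 := (Φ.inChart_inChartInv x (mem_extChartAt_target (I := 𝓘(ℝ, E)) x) w).symm.trans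
        (Φ.inChart_apply x (mem_extChartAt_source x)
          (Φ.inChartInv x (extChartAt 𝓘(ℝ, E) x x) w))
      exact (congrArg _ h2).trans (Trivialization.symm_apply_apply_mk _ hx' _)
    rw [h1, ← map_add]
    congr 1
    rw [hgt, ← hc', velocity, ← hc']
    exact (by intro a b c; abel : ∀ a b c : V, a + (b + c) = c + a + b) _ _ _
  constructor
  · rintro ⟨w, hw, rfl⟩
    exact key w hw
  · rintro ⟨u', hu', rfl⟩
    -- Here only `u` is known to be differentiable; `g` is recovered through the smooth frame, and
    -- uniqueness of derivatives identifies the two values of `u'`.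
    have hgd : DifferentiableAt ℝ g t :=
      (hF.clm_apply hu'.differentiableAt).congr_of_eventuallyEq hgu
    obtain ⟨u'', hu'', h⟩ := key _ hgd.hasDerivAt
    refine ⟨_, hgd.hasDerivAt, ?_⟩
    rw [h, hu'.unique hu'']

end ConstantFrame
end ConstantFrame

/-! ### Lie brackets of frame fields and exterior derivatives of forms with constant coefficients -/

section ConstantFrame

variable {E : Type*} [NormedAddCommGroup E] [NormedSpace ℝ E]
  {M : Type*} [TopologicalSpace M] [ChartedSpace E M] [IsManifold 𝓘(ℝ, E) ∞ M]

namespace ConstantFrame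

variable {V : Type*} [NormedAddCommGroup V] [NormedSpace ℝ V]
  {cov : CovariantDerivative 𝓘(ℝ, E) E (TangentSpace 𝓘(ℝ, E) : M → Type _)}
  (Φ : ConstantFrame V cov)

theorem hasFDerivAt_inChart [FiniteDimensional ℝ V] (x : M) {z : E}
    (hz : z ∈ (extChartAt 𝓘(ℝ, E) x).target) :
    HasFDerivAt (Φ.inChart x) (fderiv ℝ (Φ.inChart x) z) z :=
  (((Φ.contDiffOn_inChart x z hz).contDiffAt
    ((isOpen_extChartAt_target x).mem_nhds hz)).differentiableAt (by simp)).hasFDerivAt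

/-- Differentiate the identity coframe ∘ frame `= id`. -/
theorem fderiv_inChartInv_apply [FiniteDimensional ℝ V] (x : M) {z : E}
    (hz : z ∈ (extChartAt 𝓘(ℝ, E) x).target) (a : E) (v : V) :
    fderiv ℝ (Φ.inChartInv x) z a (Φ.inChart x z v)
      = -Φ.inChartInv x z (fderiv ℝ (Φ.inChart x) z a v) := by
  have h1 := ((Φ.hasFDerivAt_inChartInv x hz).clm_comp (Φ.hasFDerivAt_inChart x hz))
  have h2 : HasFDerivAt (fun z => (Φ.inChartInv x z).comp (Φ.inChart x z))
      (0 : E →L[ℝ] V →L[ℝ] V) z := by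
    refine (hasFDerivAt_const (ContinuousLinearMap.id ℝ V) z).congr_of_eventuallyEq ?_
    filter_upwards [(isOpen_extChartAt_target x).mem_nhds hz] with z hz
    ext v
    exact Φ.inChartInv_inChart x hz v
  have h3 := DFunLike.congr_fun (DFunLike.congr_fun (h1.unique h2) a) v
  simp only [add_apply, ContinuousLinearMap.comp_apply, ContinuousLinearMap.compL_apply,
    ContinuousLinearMap.flip_apply, zero_apply] at h3
  exact eq_neg_of_add_eq_zero_right h3

/-- The bracket is the flat bracket of the fields read in the chart; the preferred chart at `x` has
derivative the identity at `x`, so no correction is needed there. -/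
theorem mlieBracket_frame [FiniteDimensional ℝ V] [FiniteDimensional ℝ E] (v w : V) (x : M) :
    VectorField.mlieBracket 𝓘(ℝ, E) (fun y : M => Φ.frame y v) (fun y : M => Φ.frame y w) x
      = fderiv ℝ (Φ.inChart x) (extChartAt 𝓘(ℝ, E) x x) (Φ.frame x v) w
        - fderiv ℝ (Φ.inChart x) (extChartAt 𝓘(ℝ, E) x x) (Φ.frame x w) v := by
  have hz := mem_extChartAt_target (I := 𝓘(ℝ, E)) x
  set z := extChartAt 𝓘(ℝ, E) x x with hzdef
  let W (v : V) : E → E := VectorField.mpullbackWithin 𝓘(ℝ, E) 𝓘(ℝ, E)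
    (extChartAt 𝓘(ℝ, E) x).symm (fun y : M => Φ.frame y v) (range 𝓘(ℝ, E))
  have hpull (v : V) : W v =ᶠ[𝓝 z] fun z => Φ.inChart x z v := by
    filter_upwards [(isOpen_extChartAt_target x).mem_nhds hz] with z hz
    have h1 := mfderivWithin_extChartAt_symm_comp_mfderiv_extChartAt (I := 𝓘(ℝ, E)) hz
    have h2 := mfderiv_extChartAt_comp_mfderivWithin_extChartAt_symm (I := 𝓘(ℝ, E)) hz
    simp only [W]
    rw [VectorField.mpullbackWithin_apply, ContinuousLinearMap.inverse_eq h1 h2]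
    rfl
  have hd (v : V) : fderiv ℝ (fun z => Φ.inChart x z v) z = 
      (fderiv ℝ (Φ.inChart x) z).flip v :=
    ((ContinuousLinearMap.apply ℝ E v).hasFDerivAt.comp z (Φ.hasFDerivAt_inChart x hz)).fderiv
  have hid : (mfderiv 𝓘(ℝ, E) 𝓘(ℝ, E) (extChartAt 𝓘(ℝ, E) x) x).inverse
      = ContinuousLinearMap.id ℝ E :=
    (congrArg _ (mfderiv_extChartAt_self (I := 𝓘(ℝ, E)) (x := x))).trans
      ContinuousLinearMap.inverse_id
  rw [← VectorField.mlieBracketWithin_univ, VectorField.mlieBracketWithin_apply]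
  refine (DFunLike.congr_fun hid _).trans ?_
  have huniv : (extChartAt 𝓘(ℝ, E) x).symm ⁻¹' univ ∩ range 𝓘(ℝ, E) = univ := by simp
  change VectorField.lieBracketWithin ℝ (W v) (W w)
    ((extChartAt 𝓘(ℝ, E) x).symm ⁻¹' univ ∩ range 𝓘(ℝ, E)) z = _
  rw [huniv, VectorField.lieBracketWithin_univ]
  refine ((hpull v).lieBracket_vectorField_eq (hpull w)).trans ?_
  rw [VectorField.lieBracket, hd, hd]
  simp only [ContinuousLinearMap.flip_apply]
  rw [Φ.inChart_self, Φ.inChart_self]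

/-- The Maurer-Cartan equation for the coframe, in the preferred chart at `x`. -/
theorem fderiv_inChartInv_add_conn_symm [FiniteDimensional ℝ V] [FiniteDimensional ℝ E]
    (hT : haveI := FiniteDimensional.complete ℝ E; cov.torsion = 0) (x : M) (a b : E) :
    fderiv ℝ (Φ.inChartInv x) (extChartAt 𝓘(ℝ, E) x x) a b
        + Φ.conn (Φ.inChartInv x (extChartAt 𝓘(ℝ, E) x x) a)
          (Φ.inChartInv x (extChartAt 𝓘(ℝ, E) x x) b)
      = fderiv ℝ (Φ.inChartInv x) (extChartAt 𝓘(ℝ, E) x x) b a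
        + Φ.conn (Φ.inChartInv x (extChartAt 𝓘(ℝ, E) x x) b)
          (Φ.inChartInv x (extChartAt 𝓘(ℝ, E) x x) a) := by
  have hz := mem_extChartAt_target (I := 𝓘(ℝ, E)) x
  set z := extChartAt 𝓘(ℝ, E) x x with hzdef
  obtain ⟨v, rfl⟩ : ∃ v, Φ.inChart x z v = a := ⟨_, Φ.inChart_inChartInv x hz a⟩
  obtain ⟨w, rfl⟩ : ∃ w, Φ.inChart x z w = b := ⟨_, Φ.inChart_inChartInv x hz b⟩
  have := FiniteDimensional.complete ℝ E
  have h1 := (CovariantDerivative.torsion_eq_zero_iff cov).1 hT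
    (Φ.mdifferentiableAt x v) (Φ.mdifferentiableAt x w)
  rw [Φ.mlieBracket_frame, Φ.cov_frame, Φ.cov_frame, ← map_sub] at h1
  have h2 := congrArg (Φ.inChartInv x z) h1
  rw [← Φ.inChart_self, ← Φ.inChart_self, ← Φ.inChart_self, ← hzdef,
    Φ.inChartInv_inChart x hz] at h2
  rw [Φ.fderiv_inChartInv_apply x hz, Φ.fderiv_inChartInv_apply x hz,
    Φ.inChartInv_inChart x hz, Φ.inChartInv_inChart x hz]
  rw [map_sub] at h2
  linear_combination (norm := module) h2

/-- A form with constant coefficients in the frame. -/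
def FormHasCoeff {k : ℕ} (η : ComplexForm E M k) (α : V [⋀^Fin k]→L[ℝ] ℂ) : Prop :=
  ∀ (x : M) (v : Fin k → V), η x (fun i => Φ.frame x (v i)) = α v

variable {Φ}

theorem FormHasCoeff.inChart_eq {k : ℕ} {η : ComplexForm E M k} {α : V [⋀^Fin k]→L[ℝ] ℂ}
    (h : Φ.FormHasCoeff η α) (x : M) (z : E) :
    η.inChart x z = α.compContinuousLinearMap (Φ.inChartInv x z) := by
  ext v
  refine Eq.trans ?_ (h ((extChartAt 𝓘(ℝ, E) x).symm z) fun i => Φ.inChartInv x z (v i))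
  refine congrArg (η _) (funext fun i => ?_)
  exact ((Φ.frame ((extChartAt 𝓘(ℝ, E) x).symm z)).apply_symm_apply _).symm

/-- The expression is polynomial in `L`. Smoothness is known for multilinear maps, and a linear left
inverse of the inclusion of alternating into multilinear maps, available in finite dimension,
carries it over. -/
theorem _root_.ContinuousAlternatingMap.contDiff_compContinuousLinearMap [FiniteDimensional ℝ E]
    {k : ℕ} (α : V [⋀^Fin k]→L[ℝ] ℂ) {n : WithTop ℕ∞} :
    ContDiff ℝ n (fun L : E →L[ℝ] V => α.compContinuousLinearMap L) := by
  let ι : (E [⋀^Fin k]→L[ℝ] ℂ) →ₗ[ℝ] ContinuousMultilinearMap ℝ (fun _ : Fin k => E) ℂ :=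
    (ContinuousAlternatingMap.toContinuousMultilinearMapCLM ℝ).toLinearMap
  have : FiniteDimensional ℝ (ContinuousMultilinearMap ℝ (fun _ : Fin k => E) ℂ) :=
    FiniteDimensional.of_injective ContinuousMultilinearMap.toMultilinearMapLinear
      ContinuousMultilinearMap.toMultilinearMap_injective
  obtain ⟨r, hr⟩ := ι.exists_leftInverse_of_injective (LinearMap.ker_eq_bot.2
    ContinuousAlternatingMap.toContinuousMultilinearMap_injective)
  have h : (fun L : E →L[ℝ] V => α.compContinuousLinearMap L) = fun L =>
      r.toContinuousLinearMap (ContinuousMultilinearMap.compContinuousLinearMapLRight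
        (E := fun _ : Fin k => E) α.toContinuousMultilinearMap (fun _ => L)) :=
    funext fun L => (LinearMap.congr_fun hr (α.compContinuousLinearMap L)).symm
  rw [h]
  exact r.toContinuousLinearMap.contDiff.comp
    ((ContinuousMultilinearMap.contDiff _).comp (contDiff_pi.2 fun _ => contDiff_id))

theorem FormHasCoeff.isSmooth [FiniteDimensional ℝ V] [FiniteDimensional ℝ E] {k : ℕ} {η : ComplexForm E M k}
    {α : V [⋀^Fin k]→L[ℝ] ℂ} (h : Φ.FormHasCoeff η α) : η.IsSmooth := by
  intro x
  rw [funext (h.inChart_eq x)]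
  exact α.contDiff_compContinuousLinearMap.comp_contDiffOn (Φ.contDiffOn_inChartInv x)

/-- For a torsion-free connection the exterior derivative is the alternation of the covariant
derivative, and on constant coefficients the covariant derivative acts only through `-conn`. -/
theorem FormHasCoeff.d_apply [FiniteDimensional ℝ V] [FiniteDimensional ℝ E]
    (hT : haveI := FiniteDimensional.complete ℝ E; cov.torsion = 0) {k : ℕ} {η : ComplexForm E M k}
    {α : V [⋀^Fin k]→L[ℝ] ℂ} (h : Φ.FormHasCoeff η α) (x : M) (v : Fin (k + 1) → V) :
    η.d x (fun i => Φ.frame x (v i)) = -∑ i : Fin (k + 1), (-1 : ℤ) ^ (i : ℕ) •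
      ∑ l, α (Function.update (i.removeNth v) l (Φ.conn (v i) (i.removeNth v l))) := by
  have hz := mem_extChartAt_target (I := 𝓘(ℝ, E)) x
  set z := extChartAt 𝓘(ℝ, E) x x with hzdef
  set B := Φ.inChartInv x z with hB
  let N : E →L[ℝ] E →L[ℝ] V := (Φ.conn.bilinearComp B B)
  -- The derivative of the coframe is split as `S - N`. By the Maurer-Cartan equation `S` is
  -- symmetric, so alternation kills its contribution and only `N`, the connection term, survives.
  let S : E →L[ℝ] E →L[ℝ] V := fderiv ℝ (Φ.inChartInv x) z + N
  have hS : ∀ a b, S a b = S b a := Φ.fderiv_inChartInv_add_conn_symm hT x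
  have hderiv : HasFDerivAt (η.inChart x)
      (α.fderivCompContinuousLinearMap B ∘L (S - N)) z := by
    have h1 := (hasFDerivAt_const α z).continuousAlternatingMapCompContinuousLinearMap
      (Φ.hasFDerivAt_inChartInv x hz)
    rw [funext (h.inChart_eq x)]
    convert! h1 using 1
    simp [S, hB]
  have hext : extDeriv (η.inChart x) z = (-1 : ℝ) • ContinuousAlternatingMap.alternatizeUncurryFin
      (α.fderivCompContinuousLinearMap B ∘L N) := by
    have h1 : α.fderivCompContinuousLinearMap B ∘L (S - N) =
        α.fderivCompContinuousLinearMap B ∘L S +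
          (-1 : ℝ) • (α.fderivCompContinuousLinearMap B ∘L N) :=
      ContinuousLinearMap.ext fun a => (map_sub (α.fderivCompContinuousLinearMap B) (S a)
        (N a)).trans
        ((sub_eq_add_neg _ _).trans (congrArg _ (neg_one_smul ℝ _).symm))
    rw [extDeriv, hderiv.fderiv, h1, ContinuousAlternatingMap.alternatizeUncurryFin_add,
      ContinuousAlternatingMap.alternatizeUncurryFin_fderivCompContinuousLinearMap_eq_zero α B hS,
      zero_add, ContinuousAlternatingMap.alternatizeUncurryFin_smul]
  let e : Fin (k + 1) → E := fun i => Φ.frame x (v i)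
  have hd : η.d x (fun i => Φ.frame x (v i)) = extDeriv (η.inChart x) z e := by
    refine congrArg (extDeriv (η.inChart x) z) (funext fun i => ?_)
    exact DFunLike.congr_fun (mfderiv_extChartAt_self (I := 𝓘(ℝ, E)) (x := x)) _
  have hBe (i) : B (e i) = v i :=
    (Φ.inChartInv_self x _).trans ((Φ.frame x).symm_apply_apply (v i))
  rw [hd, hext, ContinuousAlternatingMap.smul_apply, neg_one_smul,
    ContinuousAlternatingMap.alternatizeUncurryFin_apply]
  refine congrArg Neg.neg (Finset.sum_congr rfl fun i _ => ?_)
  rw [ContinuousLinearMap.comp_apply, ContinuousAlternatingMap.fderivCompContinuousLinearMap_apply]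
  congr 1
  refine Finset.sum_congr rfl fun l _ => congrArg α (funext fun m => ?_)
  by_cases hm : m = l
  · subst hm
    simp [N, hBe, Fin.removeNth]
  · rw [Function.update_of_ne hm, Function.update_of_ne hm]
    exact hBe _

end ConstantFrame
end ConstantFrame

/-! ### Linear differential equations -/

section LinearODE

variable {V : Type*} [NormedAddCommGroup V] [NormedSpace ℝ V]

/-- `u` solves `u' = -A u` on `[0, 1]`. -/
def IsSolution (A : ℝ → V →L[ℝ] V) (u : ℝ → V) : Prop :=
  ∀ t ∈ Icc (0 : ℝ) 1, HasDerivAt u (-A t (u t)) t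

theorem IsSolution.unique {A : ℝ → V →L[ℝ] V} (hA : Continuous A) {u w : ℝ → V}
    (hu : IsSolution A u) (hw : IsSolution A w) (h0 : u 0 = w 0) : u 1 = w 1 := by
  obtain ⟨K, hK⟩ := isCompact_Icc.exists_bound_of_continuousOn
    (hA.continuousOn (s := Icc (0 : ℝ) 1))
  have hcont {u : ℝ → V} (hu : IsSolution A u) : ContinuousOn u (Icc 0 1) :=
    fun t ht => (hu t ht).continuousAt.continuousWithinAt
  refine ODE_solution_unique_of_mem_Icc_right (v := fun t x => -A t x) (K := K.toNNReal)
    (s := fun _ => univ) (fun t ht => ?_)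
    (hcont hu) (fun t ht => (hu t (Ico_subset_Icc_self ht)).hasDerivWithinAt)
    (fun _ _ => mem_univ _) (hcont hw)
    (fun t ht => (hw t (Ico_subset_Icc_self ht)).hasDerivWithinAt)
    (fun _ _ => mem_univ _) h0 (right_mem_Icc.2 zero_le_one)
  refine LipschitzWith.lipschitzOnWith ?_
  refine ((-A t).lipschitz).weaken ?_
  rw [← NNReal.coe_le_coe, coe_nnnorm, norm_neg]
  exact (hK t (Ico_subset_Icc_self ht)).trans (Real.le_coe_toNNReal K)

/-- Liouville's formula. -/
theorem det_eq_exp_of_isSolution [FiniteDimensional ℝ V] {A : ℝ → V →L[ℝ] V} (hA : Continuous A)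
    {P : V →ₗ[ℝ] V} (hP : ∀ v, ∃ u, IsSolution A u ∧ u 0 = v ∧ u 1 = P v) :
    LinearMap.det P = Real.exp (-∫ t in (0 : ℝ)..1, LinearMap.trace ℝ V (A t).toLinearMap) := by
  let b := Module.finBasis ℝ V
  choose u hu hu0 hu1 using fun i => hP (b i)
  let f : ContinuousMultilinearMap ℝ (fun _ : Fin (Module.finrank ℝ V) => V) ℝ :=
    { b.det with
      cont := by
        change Continuous fun v : Fin (Module.finrank ℝ V) → V => b.det v
        simp only [Module.Basis.det_apply]
        refine Continuous.matrix_det (continuous_matrix fun a c => ?_)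
        exact (b.coord a).continuous_of_finiteDimensional.comp (continuous_apply c) }
  let τ : ℝ → ℝ := fun t => LinearMap.trace ℝ V (A t).toLinearMap
  have hτ : Continuous τ :=
    ((LinearMap.trace ℝ V ∘ₗ ContinuousLinearMap.coeLM ℝ).continuous_of_finiteDimensional).comp hA
  let D : ℝ → ℝ := fun t => f fun i => u i t
  have hD (t : ℝ) (ht : t ∈ Icc (0 : ℝ) 1) : HasDerivAt D (-τ t * D t) t := by
    have h1 : HasDerivAt (fun s i => u i s) (fun i => -A t (u i t)) t :=
      hasDerivAt_pi.2 fun i => hu i t ht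
    have h2 := (f.hasFDerivAt (fun i => u i t)).comp_hasDerivAt t h1
    refine h2.congr_deriv ?_
    -- The derivative of the determinant of the solution basis replaces one column at a time by its
    -- image under `-A t`, which gives `D' = -τ D`.
    have h3 := AlternatingMap.sum_update_eq_trace_mul b b.det (-(A t).toLinearMap) (fun i => u i t)
    rw [map_neg] at h3
    rw [ContinuousMultilinearMap.linearDeriv_apply]
    exact h3
  let F : ℝ → ℝ := fun t => ∫ s in (0 : ℝ)..t, τ s
  have hF (t : ℝ) : HasDerivAt F (τ t) t :=
    intervalIntegral.integral_hasDerivAt_right (hτ.intervalIntegrable _ _)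
      (hτ.stronglyMeasurableAtFilter _ _) hτ.continuousAt
  have hconst (t : ℝ) (ht : t ∈ Icc (0 : ℝ) 1) :
      HasDerivAt (fun t => D t * Real.exp (F t)) 0 t := by
    refine ((hD t ht).mul (hF t).exp).congr_deriv ?_
    ring
  have h := constant_of_has_deriv_right_zero
    (fun t ht => (hconst t ht).continuousAt.continuousWithinAt)
    (fun t ht => (hconst t (Ico_subset_Icc_self ht)).hasDerivWithinAt) 1 (right_mem_Icc.2 zero_le_one)
  have hD0 : D 0 = 1 := by
    simp only [D, hu0]
    exact b.det_self
  have hD1 : D 1 = LinearMap.det P := by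
    simp only [D, hu1]
    have := b.det_comp P b
    rw [b.det_self, mul_one] at this
    exact this
  have hF0 : F 0 = 0 := intervalIntegral.integral_same
  simp only [hD0, hD1, hF0, Real.exp_zero, mul_one] at h
  rw [Real.exp_neg]
  exact eq_inv_of_mul_eq_one_left h

/-- A single Picard-Lindelöf step suffices for small `A`. The interval `[-1, 2]` contains `[0, 1]`
in its interior, so the derivatives at both endpoints are two-sided. -/
theorem exists_isSolution [CompleteSpace V] {A : ℝ → V →L[ℝ] V} (hA : Continuous A)
    (hle : ∀ t ∈ Icc (-1 : ℝ) 2, ‖A t‖ ≤ 1 / 4) (v : V) : ∃ u, IsSolution A u ∧ u 0 = v := by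
  let a : NNReal := ‖v‖₊ + 1
  have hball {x : V} (hx : x ∈ Metric.closedBall v a) : ‖x‖ ≤ 2 * a := by
    have h1 : ‖x‖ ≤ ‖x - v‖ + ‖v‖ := by simpa using norm_add_le (x - v) v
    rw [mem_closedBall_iff_norm] at hx
    have : (a : ℝ) = ‖v‖ + 1 := rfl
    linarith
  -- On the ball of radius `a` about `v` the norm is at most `2 * a`, so the speed is at most `a /
  -- 2`. The longest time from `0` is `2`, so the solution stays in the ball.
  have hPL : IsPicardLindelof (fun t x => -A t x) (tmin := -1) (tmax := 2)
      ⟨0, by norm_num, by norm_num⟩ v a 0 (a / 2) (1 / 4) := by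
    constructor
    · intro t ht
      refine LipschitzWith.lipschitzOnWith (((-A t).lipschitz).weaken ?_)
      rw [← NNReal.coe_le_coe, coe_nnnorm, norm_neg]
      simpa using hle t ht
    · intro x _
      fun_prop
    · intro t ht x hx
      rw [norm_neg]
      calc ‖A t x‖ ≤ ‖A t‖ * ‖x‖ := (A t).le_opNorm x
        _ ≤ 1 / 4 * (2 * a) := by
          gcongr
          · exact hle t ht
          · exact hball hx
        _ = ((a / 2 : NNReal) : ℝ) := by push_cast; ring
    · push_cast
      norm_num
  obtain ⟨u, hu0, hu⟩ := hPL.exists_eq_forall_mem_Icc_hasDerivWithinAt₀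
  refine ⟨u, fun t ht => ?_, hu0⟩
  exact (hu t ⟨by linarith [ht.1], by linarith [ht.2]⟩).hasDerivAt
    (Icc_mem_nhds (by linarith [ht.1]) (by linarith [ht.2]))

theorem exists_linearEquiv_isSolution [FiniteDimensional ℝ V] {A : ℝ → V →L[ℝ] V}
    (hA : Continuous A) (hle : ∀ t ∈ Icc (-1 : ℝ) 2, ‖A t‖ ≤ 1 / 4) :
    ∃ P : V ≃ₗ[ℝ] V, ∀ v, ∃ u, IsSolution A u ∧ u 0 = v ∧ u 1 = P v := by
  have := FiniteDimensional.complete ℝ V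
  choose u hu hu0 using exists_isSolution hA hle
  let P : V →ₗ[ℝ] V :=
    { toFun := fun v => u v 1
      map_add' := fun v w => by
        refine IsSolution.unique (w := fun t => u v t + u w t) hA (hu _) (fun t ht => ?_) (by simp [hu0])
        exact ((hu v t ht).add (hu w t ht)).congr_deriv (by rw [map_add, neg_add])
      map_smul' := fun r v => by
        refine IsSolution.unique (w := fun t => r • u v t) hA (hu _) (fun t ht => ?_) (by simp [hu0])
        exact ((hu v t ht).const_smul r).congr_deriv (by rw [map_smul, smul_neg]) }
  have hP (v) : ∃ w, IsSolution A w ∧ w 0 = v ∧ w 1 = P v := ⟨u v, hu v, hu0 v, rfl⟩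
  -- Invertibility of the time-one map comes from Liouville's formula, not from solving backwards.
  have hdet : IsUnit (LinearMap.det P) := by
    rw [det_eq_exp_of_isSolution hA hP]
    exact (Real.exp_pos _).ne'.isUnit
  exact ⟨LinearEquiv.ofIsUnitDet (f := P) (v := Module.finBasis ℝ V) (v' := Module.finBasis ℝ V)
    (by rwa [← LinearMap.det_toMatrix (Module.finBasis ℝ V)] at hdet), hP⟩

end LinearODE

/-! ### Parallel transport in a frame with constant coefficients -/

section ConstantFrame

variable {E : Type*} [NormedAddCommGroup E] [NormedSpace ℝ E]
  {M : Type*} [TopologicalSpace M] [ChartedSpace E M] [IsManifold 𝓘(ℝ, E) ∞ M]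

namespace ConstantFrame

variable {V : Type*} [NormedAddCommGroup V] [NormedSpace ℝ V]
  {cov : CovariantDerivative 𝓘(ℝ, E) E (TangentSpace 𝓘(ℝ, E) : M → Type _)}
  (Φ : ConstantFrame V cov)

theorem velocity_eq_inChartInv (x : M) {c : ℝ → M} {t : ℝ}
    (hc : MDifferentiableAt 𝓘(ℝ, ℝ) 𝓘(ℝ, E) c t) (hx : c t ∈ (extChartAt 𝓘(ℝ, E) x).source) :
    Φ.velocity c t = Φ.inChartInv x (extChartAt 𝓘(ℝ, E) x (c t))
      (deriv (fun s => extChartAt 𝓘(ℝ, E) x (c s)) t) := by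
  have hφ : MDifferentiableAt 𝓘(ℝ, E) 𝓘(ℝ, E) (extChartAt 𝓘(ℝ, E) x) (c t) :=
    mdifferentiableAt_extChartAt (by simpa using hx)
  have h1 : deriv (fun s => extChartAt 𝓘(ℝ, E) x (c s)) t
      = mfderiv 𝓘(ℝ, E) 𝓘(ℝ, E) (extChartAt 𝓘(ℝ, E) x) (c t)
        (mfderiv 𝓘(ℝ, ℝ) 𝓘(ℝ, E) c t (1 : ℝ)) := by
    refine Eq.trans ?_ (mfderiv_comp_apply (f := c) t hφ hc (1 : ℝ))
    exact (fderiv_apply_one_eq_deriv).symm.trans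
      (DFunLike.congr_fun (mfderiv_eq_fderiv (f := extChartAt 𝓘(ℝ, E) x ∘ c)).symm (1 : ℝ))
  have h2 : mfderiv 𝓘(ℝ, E) 𝓘(ℝ, E) (extChartAt 𝓘(ℝ, E) x) (c t)
        (mfderiv 𝓘(ℝ, ℝ) 𝓘(ℝ, E) c t (1 : ℝ))
      = Φ.inChart x (extChartAt 𝓘(ℝ, E) x (c t)) (Φ.velocity c t) := by
    simp only [inChart, velocity]
    rw [(extChartAt 𝓘(ℝ, E) x).left_inv hx]
    exact congrArg (mfderiv 𝓘(ℝ, E) 𝓘(ℝ, E) (extChartAt 𝓘(ℝ, E) x) (c t))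
      ((Φ.frame (c t)).apply_symm_apply _).symm
  have h3 := (Φ.inChartInv_inChart x ((extChartAt 𝓘(ℝ, E) x).map_source hx)
    (Φ.velocity c t)).symm
  exact h3.trans (congrArg _ (h1.trans h2).symm)

theorem continuous_velocity [FiniteDimensional ℝ V] {c : ℝ → M}
    (hc : ContMDiff 𝓘(ℝ, ℝ) 𝓘(ℝ, E) ∞ c) : Continuous (Φ.velocity c) := by
  rw [continuous_iff_continuousAt]
  intro t
  set x := c t with hx
  have hsrc : ∀ᶠ s in 𝓝 t, c s ∈ (extChartAt 𝓘(ℝ, E) x).source :=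
    hc.continuous.continuousAt.eventually (extChartAt_source_mem_nhds (I := 𝓘(ℝ, E)) x)
  have hsm : ContDiffAt ℝ ∞ (fun s => extChartAt 𝓘(ℝ, E) x (c s)) t :=
    ((contMDiffAt_extChartAt (I := 𝓘(ℝ, E)) (x := x)).comp t (hc t)).contDiffAt
  have hd : ContinuousAt (deriv fun s => extChartAt 𝓘(ℝ, E) x (c s)) t :=
    (hsm.fderiv_right (m := 0) (by simp)).continuousAt.clm_apply continuousAt_const
  have hB : ContinuousAt (Φ.inChartInv x) (extChartAt 𝓘(ℝ, E) x (c t)) :=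
    (Φ.hasFDerivAt_inChartInv x (mem_extChartAt_target (I := 𝓘(ℝ, E)) x)).continuousAt
  refine ((hB.comp (f := fun s => extChartAt 𝓘(ℝ, E) x (c s))
    hsm.continuousAt).clm_apply hd).congr ?_
  filter_upwards [hsrc] with s hs
  exact (Φ.velocity_eq_inChartInv x (hc.mdifferentiable (by simp) s) hs).symm

/-- The matrix of a linear equivalence between tangent spaces in the frame. -/
noncomputable def coord {x y : M} (P : TangentSpace 𝓘(ℝ, E) x ≃ₗ[ℝ] TangentSpace 𝓘(ℝ, E) y) :
    V ≃ₗ[ℝ] V :=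
  (Φ.frame x).toLinearEquiv.trans (P.trans (Φ.frame y).symm.toLinearEquiv)

theorem coord_apply {x y : M} (P : TangentSpace 𝓘(ℝ, E) x ≃ₗ[ℝ] TangentSpace 𝓘(ℝ, E) y) (v : V) :
    Φ.coord P v = (Φ.frame y).symm (P (Φ.frame x v)) := rfl

theorem frame_coord {x y : M} (P : TangentSpace 𝓘(ℝ, E) x ≃ₗ[ℝ] TangentSpace 𝓘(ℝ, E) y) (v : V) :
    Φ.frame y (Φ.coord P v) = P (Φ.frame x v) :=
  (Φ.frame y).apply_symm_apply _

theorem coord_trans {x y z : M} (P : TangentSpace 𝓘(ℝ, E) x ≃ₗ[ℝ] TangentSpace 𝓘(ℝ, E) y)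
    (Q : TangentSpace 𝓘(ℝ, E) y ≃ₗ[ℝ] TangentSpace 𝓘(ℝ, E) z) :
    Φ.coord (P.trans Q) = (Φ.coord P).trans (Φ.coord Q) := by
  ext v
  simp [coord_apply]

/-- The coefficient matrix of the equation of parallel transport along a curve. -/
noncomputable def transportMatrix (c : ℝ → M) (t : ℝ) : V →L[ℝ] V := Φ.conn (Φ.velocity c t)

theorem continuous_transportMatrix [FiniteDimensional ℝ V] {c : ℝ → M}
    (hc : ContMDiff 𝓘(ℝ, ℝ) 𝓘(ℝ, E) ∞ c) : Continuous (Φ.transportMatrix c) :=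
  Φ.conn.continuous.comp (Φ.continuous_velocity hc)

theorem exists_parallel_iff [FiniteDimensional ℝ V] {c : ℝ → M}
    (hc : ContMDiff 𝓘(ℝ, ℝ) 𝓘(ℝ, E) ∞ c)
    (P : TangentSpace 𝓘(ℝ, E) (c 0) ≃ₗ[ℝ] TangentSpace 𝓘(ℝ, E) (c 1)) :
    (∀ v, ∃ U : ∀ t, TangentSpace 𝓘(ℝ, E) (c t),
        (∀ t ∈ Icc (0 : ℝ) 1, HasCovDerivAlong cov c U t 0) ∧ U 0 = v ∧ U 1 = P v) ↔
      ∀ v, ∃ u, IsSolution (Φ.transportMatrix c) u ∧ u 0 = v ∧ u 1 = Φ.coord P v := by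
  have hd (t) : MDifferentiableAt 𝓘(ℝ, ℝ) 𝓘(ℝ, E) c t := hc.mdifferentiable (by simp) t
  constructor
  · intro h v
    obtain ⟨U, hU, h0, h1⟩ := h (Φ.frame (c 0) v)
    refine ⟨fun s => (Φ.frame (c s)).symm (U s), fun t ht => ?_, ?_, ?_⟩
    · obtain ⟨u', hu', h'⟩ := (Φ.hasCovDerivAlong_iff (hd t) U 0).1 (hU t ht)
      have h'' : u' + Φ.conn (Φ.velocity c t) ((Φ.frame (c t)).symm (U t)) = 0 :=
        (Φ.frame (c t)).map_eq_zero_iff.1 h'.symm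
      rwa [eq_neg_of_add_eq_zero_left h''] at hu'
    · simp [h0]
    · simp [h1, coord_apply]
  · intro h v
    obtain ⟨u, hu, h0, h1⟩ := h ((Φ.frame (c 0)).symm v)
    refine ⟨fun s => Φ.frame (c s) (u s), fun t ht => ?_, ?_, ?_⟩
    · refine (Φ.hasCovDerivAlong_iff (hd t) _ 0).2 ⟨-Φ.transportMatrix c t (u t), ?_, ?_⟩
      · simpa using hu t ht
      · simp [transportMatrix]
    · simp [h0]
    · simp [h1, frame_coord]

theorem det_coord_eq_one [FiniteDimensional ℝ V]
    (hτ : ∀ v, LinearMap.trace ℝ V (Φ.conn v).toLinearMap = 0) {x y : M}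
    {P : TangentSpace 𝓘(ℝ, E) x ≃ₗ[ℝ] TangentSpace 𝓘(ℝ, E) y} (hP : IsParallelTransport cov P) :
    LinearMap.det (Φ.coord P : V →ₗ[ℝ] V) = 1 := by
  induction hP with
  | smooth c hc P hP =>
    rw [det_eq_exp_of_isSolution (Φ.continuous_transportMatrix hc)
      ((Φ.exists_parallel_iff hc P).1 hP)]
    simp [transportMatrix, hτ]
  | trans P Q _ _ hP hQ =>
    rw [Φ.coord_trans, LinearEquiv.coe_trans, LinearMap.det_comp, hP, hQ, one_mul]

/-- If `u` solves the transport equation, so does `j ∘ u`; uniqueness with equal initial values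
identifies the endpoints. -/
theorem coord_comm [FiniteDimensional ℝ V] {j : V →L[ℝ] V}
    (hj : ∀ v w, Φ.conn v (j w) = j (Φ.conn v w)) {x y : M}
    {P : TangentSpace 𝓘(ℝ, E) x ≃ₗ[ℝ] TangentSpace 𝓘(ℝ, E) y} (hP : IsParallelTransport cov P)
    (v : V) : Φ.coord P (j v) = j (Φ.coord P v) := by
  induction hP generalizing v with
  | smooth c hc P hP =>
    have h := (Φ.exists_parallel_iff hc P).1 hP
    obtain ⟨u, hu, h0, h1⟩ := h v
    obtain ⟨w, hw, h0', h1'⟩ := h (j v)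
    rw [← h1, ← h1']
    refine hw.unique (Φ.continuous_transportMatrix hc) (w := fun t => j (u t)) (fun t ht => ?_)
      (by rw [h0, h0'])
    have e : -Φ.transportMatrix c t (j (u t)) = j (-Φ.transportMatrix c t (u t)) := by
      rw [map_neg]
      exact congrArg _ (hj _ _)
    rw [e]
    exact j.hasFDerivAt.comp_hasDerivAt t (hu t ht)
  | trans P Q _ _ hP hQ => simp [Φ.coord_trans, hP, hQ]

theorem exists_isParallelTransport_of_curve [FiniteDimensional ℝ V] {c : ℝ → M}
    (hc : ContMDiff 𝓘(ℝ, ℝ) 𝓘(ℝ, E) ∞ c) {y z : M} (h0 : c 0 = y) (h1 : c 1 = z)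
    (hle : ∀ t ∈ Icc (-1 : ℝ) 2, ‖Φ.transportMatrix c t‖ ≤ 1 / 4) :
    ∃ P : TangentSpace 𝓘(ℝ, E) y ≃ₗ[ℝ] TangentSpace 𝓘(ℝ, E) z, IsParallelTransport cov P ∧
      LinearMap.det (Φ.coord P : V →ₗ[ℝ] V) = Real.exp
        (-∫ t in (0 : ℝ)..1, LinearMap.trace ℝ V (Φ.transportMatrix c t).toLinearMap) := by
  subst h0 h1
  obtain ⟨Q, hQ⟩ := exists_linearEquiv_isSolution (Φ.continuous_transportMatrix hc) hle
  let P : TangentSpace 𝓘(ℝ, E) (c 0) ≃ₗ[ℝ] TangentSpace 𝓘(ℝ, E) (c 1) :=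
    (Φ.frame (c 0)).symm.toLinearEquiv.trans (Q.trans (Φ.frame (c 1)).toLinearEquiv)
  have hPQ : Φ.coord P = Q := by
    ext v
    simp [P, coord_apply]
  refine ⟨P, .smooth c hc P ((Φ.exists_parallel_iff hc P).2 ?_), ?_⟩
  · rwa [hPQ]
  · rw [hPQ]
    exact det_eq_exp_of_isSolution (Φ.continuous_transportMatrix hc) hQ

end ConstantFrame
end ConstantFrame

/-! ### Holonomy with determinant one on a compact manifold -/

section ConstantFrame

variable {E : Type*} [NormedAddCommGroup E] [NormedSpace ℝ E]
  {M : Type*} [TopologicalSpace M] [ChartedSpace E M] [IsManifold 𝓘(ℝ, E) ∞ M]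

namespace ConstantFrame

variable {V : Type*} [NormedAddCommGroup V] [NormedSpace ℝ V]
  {cov : CovariantDerivative 𝓘(ℝ, E) E (TangentSpace 𝓘(ℝ, E) : M → Type _)}
  (Φ : ConstantFrame V cov)

/-- The trace of the connection form. -/
noncomputable def traceForm [FiniteDimensional ℝ V] : V →L[ℝ] ℝ :=
  ((LinearMap.trace ℝ V).comp (ContinuousLinearMap.coeLM ℝ)).toContinuousLinearMap.comp Φ.conn

/-- Transport along a chart segment between two points near `x`. Stating the integral of the trace
as its value at an intermediate point of the segment's line makes it usable as a mean value formula
for the potential. -/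
theorem exists_isParallelTransport_near [FiniteDimensional ℝ V] (x : M) :
    ∃ r > 0, ∃ C, Metric.ball (extChartAt 𝓘(ℝ, E) x x) r ⊆ (extChartAt 𝓘(ℝ, E) x).target ∧
      (∀ z ∈ Metric.ball (extChartAt 𝓘(ℝ, E) x x) (3 * r), ‖Φ.inChartInv x z‖ ≤ C) ∧
      ∀ y ∈ (extChartAt 𝓘(ℝ, E) x).source, ∀ z ∈ (extChartAt 𝓘(ℝ, E) x).source,
        extChartAt 𝓘(ℝ, E) x y ∈ Metric.ball (extChartAt 𝓘(ℝ, E) x x) r →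
        extChartAt 𝓘(ℝ, E) x z ∈ Metric.ball (extChartAt 𝓘(ℝ, E) x x) r →
        ∃ P : TangentSpace 𝓘(ℝ, E) y ≃ₗ[ℝ] TangentSpace 𝓘(ℝ, E) z, IsParallelTransport cov P ∧
          ∃ ξ : ℝ, |ξ| ≤ 1 ∧ LinearMap.det (Φ.coord P : V →ₗ[ℝ] V) = Real.exp
            (-Φ.traceForm (Φ.inChartInv x (extChartAt 𝓘(ℝ, E) x y
              + ξ • (extChartAt 𝓘(ℝ, E) x z - extChartAt 𝓘(ℝ, E) x y))
              (extChartAt 𝓘(ℝ, E) x z - extChartAt 𝓘(ℝ, E) x y))) := by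
  set a := extChartAt 𝓘(ℝ, E) x x with ha
  have ha' : a ∈ (extChartAt 𝓘(ℝ, E) x).target := mem_extChartAt_target (I := 𝓘(ℝ, E)) x
  have hBcont : ContinuousAt (Φ.inChartInv x) a := (Φ.hasFDerivAt_inChartInv x ha').continuousAt
  obtain ⟨r₀, hr₀, hball⟩ := Metric.eventually_nhds_iff_ball.1
    (((isOpen_extChartAt_target (I := 𝓘(ℝ, E)) x).eventually_mem ha').and
      (hBcont.norm.eventually (gt_mem_nhds (lt_add_one ‖Φ.inChartInv x a‖))))
  set C := ‖Φ.inChartInv x a‖ + 1 with hC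
  have hC0 : 0 < C := by positivity
  -- The first bound keeps the ball of radius `3 * r`, which contains the whole curve, where the
  -- coframe is controlled. The second makes the transport matrix, of norm at most `‖Φ.conn‖ * 2 * C
  -- * 2 * r`, at most `1 / 4`.
  set r := min (r₀ / 3) (1 / (16 * (‖Φ.conn‖ + 1) * C)) with hr
  have hr0 : 0 < r := lt_min (by positivity) (by positivity)
  have h3r : 3 * r ≤ r₀ := by linarith [min_le_left (r₀ / 3) (1 / (16 * (‖Φ.conn‖ + 1) * C))]
  have hr1 : r * (16 * (‖Φ.conn‖ + 1) * C) ≤ 1 :=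
    (le_div_iff₀ (by positivity)).1 (min_le_right _ _)
  have hball' : ∀ z ∈ Metric.ball a (3 * r), z ∈ (extChartAt 𝓘(ℝ, E) x).target ∧
      ‖Φ.inChartInv x z‖ < C := fun z hz => hball z (Metric.ball_subset_ball h3r hz)
  refine ⟨r, hr0, C, fun z hz => (hball' z (Metric.ball_subset_ball (by linarith) hz)).1,
    fun z hz => (hball' z hz).2.le, fun y hys z hzs hy hz => ?_⟩
  set p := extChartAt 𝓘(ℝ, E) x y with hp
  set w := extChartAt 𝓘(ℝ, E) x z - p with hw
  have hy' : ‖p - a‖ < r := by rwa [← dist_eq_norm]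
  have hwr : ‖w‖ ≤ 2 * r := by
    have : w = (extChartAt 𝓘(ℝ, E) x z - a) - (p - a) := by rw [hw]; abel
    rw [this]
    have hz' : ‖extChartAt 𝓘(ℝ, E) x z - a‖ < r := by rwa [← dist_eq_norm]
    linarith [norm_sub_le (extChartAt 𝓘(ℝ, E) x z - a) (p - a)]
  have hmem {s : ℝ} (hs : |s| ≤ 1) : p + s • w ∈ Metric.ball a (3 * r) := by
    rw [Metric.mem_ball, dist_eq_norm, add_sub_right_comm]
    have : ‖s • w‖ ≤ ‖w‖ := by
      rw [norm_smul]
      exact mul_le_of_le_one_left (norm_nonneg w) hs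
    linarith [norm_add_le (p - a) (s • w)]
  -- The curve must be smooth on all of `ℝ` without leaving the chart. This parameter is bounded by
  -- `1`, goes from `0` to `1` on `[0, 1]` and is monotone there, so that `ρ'` can serve as a
  -- nonnegative weight.
  let ρ : ℝ → ℝ := fun t => Real.sin (Real.pi / 2 * t)
  let ρ' : ℝ → ℝ := fun t => Real.pi / 2 * Real.cos (Real.pi / 2 * t)
  have hρ (t) : HasDerivAt ρ (ρ' t) t := by
    have := ((hasDerivAt_id t).const_mul (Real.pi / 2)).sin
    simpa [ρ, ρ', mul_comm] using this
  have hρ1 (t) : |ρ t| ≤ 1 := Real.abs_sin_le_one _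
  have hρs : ContDiff ℝ ∞ ρ := Real.contDiff_sin.comp (contDiff_const.mul contDiff_id)
  have hρ'c : Continuous ρ' := by fun_prop
  have hρ'2 (t) : |ρ' t| ≤ 2 := by
    have h1 := Real.abs_cos_le_one (Real.pi / 2 * t)
    rw [abs_mul, abs_of_pos Real.pi_div_two_pos]
    nlinarith [Real.pi_le_four, Real.pi_pos, abs_nonneg (Real.cos (Real.pi / 2 * t))]
  let γ : ℝ → E := fun t => p + ρ t • w
  have hγ (t) : HasDerivAt γ (ρ' t • w) t := ((hρ t).smul_const w).const_add p
  have hγm (t) : γ t ∈ (extChartAt 𝓘(ℝ, E) x).target := (hball' _ (hmem (hρ1 t))).1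
  let c : ℝ → M := fun t => (extChartAt 𝓘(ℝ, E) x).symm (γ t)
  have hc : ContMDiff 𝓘(ℝ, ℝ) 𝓘(ℝ, E) ∞ c := by
    have h1 : ContMDiff 𝓘(ℝ, ℝ) 𝓘(ℝ, E) ∞ γ :=
      (contDiff_const.add (hρs.smul contDiff_const)).contMDiff
    exact (contMDiffOn_extChartAt_symm x).comp_contMDiff h1 hγm
  have hφc (t) : extChartAt 𝓘(ℝ, E) x (c t) = γ t := (extChartAt 𝓘(ℝ, E) x).right_inv (hγm t)
  have hvel (t) : Φ.velocity c t = ρ' t • Φ.inChartInv x (γ t) w := by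
    rw [Φ.velocity_eq_inChartInv x (hc.mdifferentiable (by simp) t)
      ((extChartAt 𝓘(ℝ, E) x).map_target (hγm t))]
    simp only [hφc]
    rw [(hγ t).deriv, map_smul]
  have h0 : c 0 = y := by
    simp only [c, γ, ρ, mul_zero, Real.sin_zero, zero_smul, add_zero]
    exact (extChartAt 𝓘(ℝ, E) x).left_inv hys
  have h1 : c 1 = z := by
    simp only [c, γ, ρ, mul_one, Real.sin_pi_div_two, one_smul, hw, add_sub_cancel]
    exact (extChartAt 𝓘(ℝ, E) x).left_inv hzs
  have hle (t) : ‖Φ.transportMatrix c t‖ ≤ 1 / 4 := by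
    have hB : ‖Φ.inChartInv x (γ t) w‖ ≤ C * (2 * r) :=
      (ContinuousLinearMap.le_opNorm _ _).trans
        (mul_le_mul (hball' _ (hmem (hρ1 t))).2.le hwr (norm_nonneg _) hC0.le)
    have hv : ‖Φ.velocity c t‖ ≤ 2 * (C * (2 * r)) := by
      rw [hvel, norm_smul]
      exact mul_le_mul (hρ'2 t) hB (norm_nonneg _) zero_le_two
    have : ‖Φ.transportMatrix c t‖ ≤ ‖Φ.conn‖ * (2 * (C * (2 * r))) :=
      (Φ.conn.le_opNorm _).trans (mul_le_mul_of_nonneg_left hv (norm_nonneg _))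
    nlinarith [mul_pos hC0 hr0]
  obtain ⟨P, hP, hdet⟩ := Φ.exists_isParallelTransport_of_curve hc h0 h1 fun t _ => hle t
  refine ⟨P, hP, ?_⟩
  have hcont : Continuous fun t => Φ.traceForm (Φ.inChartInv x (γ t) w) := by
    have hγc : Continuous γ := continuous_iff_continuousAt.2 fun t => (hγ t).continuousAt
    have := ((Φ.contDiffOn_inChartInv x).continuousOn).comp_continuous hγc hγm
    exact Φ.traceForm.continuous.comp (this.clm_apply continuous_const)
  have hpos : ∀ t ∈ Set.uIoc (0 : ℝ) 1, 0 ≤ ρ' t := by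
    intro t ht
    rw [uIoc_of_le zero_le_one] at ht
    refine mul_nonneg Real.pi_div_two_pos.le (Real.cos_nonneg_of_mem_Icc ⟨?_, ?_⟩) <;>
      nlinarith [Real.pi_pos, ht.1, ht.2]
  -- Mean value theorem for integrals with weight `ρ'`, whose total mass on `[0, 1]` is one.
  obtain ⟨ξ, -, hξ⟩ := exists_eq_const_mul_intervalIntegral_of_nonneg
    (μ := MeasureTheory.volume) hcont.continuousOn (hρ'c.intervalIntegrable 0 1) hpos
  have hone : ∫ t in (0 : ℝ)..1, ρ' t = 1 := by
    rw [intervalIntegral.integral_eq_sub_of_hasDerivAt (fun t _ => hρ t)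
      (hρ'c.intervalIntegrable 0 1)]
    simp [ρ]
  refine ⟨ρ ξ, hρ1 ξ, hdet.trans ?_⟩
  rw [hone, mul_one] at hξ
  refine congrArg (fun a => Real.exp (-a)) (Eq.trans ?_ hξ)
  refine intervalIntegral.integral_congr fun t _ => ?_
  change Φ.traceForm (Φ.velocity c t) = _
  rw [hvel, map_smul, smul_eq_mul, mul_comm]

theorem abs_det_coord_trans [FiniteDimensional ℝ V] {x y z : M}
    (P : TangentSpace 𝓘(ℝ, E) x ≃ₗ[ℝ] TangentSpace 𝓘(ℝ, E) y)
    (Q : TangentSpace 𝓘(ℝ, E) y ≃ₗ[ℝ] TangentSpace 𝓘(ℝ, E) z) :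
    Real.log |LinearMap.det (Φ.coord (P.trans Q) : V →ₗ[ℝ] V)|
      = Real.log |LinearMap.det (Φ.coord P : V →ₗ[ℝ] V)|
        + Real.log |LinearMap.det (Φ.coord Q : V →ₗ[ℝ] V)| := by
  rw [Φ.coord_trans, LinearEquiv.coe_trans, LinearMap.det_comp, abs_mul, add_comm,
    Real.log_mul (abs_ne_zero.2 (Φ.coord Q).isUnit_det'.ne_zero)
      (abs_ne_zero.2 (Φ.coord P).isUnit_det'.ne_zero)]

/-- If all parallel transports along loops have determinant one, the logarithm of the determinant
of parallel transport is the difference of a potential. -/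
theorem exists_potential [FiniteDimensional ℝ V]
    (hdet : ∀ (x : M) (P : TangentSpace 𝓘(ℝ, E) x ≃ₗ[ℝ] TangentSpace 𝓘(ℝ, E) x),
      IsParallelTransport cov P → LinearMap.det (Φ.coord P : V →ₗ[ℝ] V) = 1) :
    ∃ f : M → ℝ, ∀ (y z : M) (P : TangentSpace 𝓘(ℝ, E) y ≃ₗ[ℝ] TangentSpace 𝓘(ℝ, E) z)
      (Q : TangentSpace 𝓘(ℝ, E) z ≃ₗ[ℝ] TangentSpace 𝓘(ℝ, E) y),
      IsParallelTransport cov P → IsParallelTransport cov Q →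
      f z - f y = Real.log |LinearMap.det (Φ.coord P : V →ₗ[ℝ] V)| := by
  let T (y z : M) : Prop :=
    ∃ P : TangentSpace 𝓘(ℝ, E) y ≃ₗ[ℝ] TangentSpace 𝓘(ℝ, E) z, IsParallelTransport cov P
  have hT {x y z : M} : T x y → T y z → T x z := fun ⟨P, hP⟩ ⟨Q, hQ⟩ => ⟨_, hP.trans _ _ hQ⟩
  -- Two points are related if transports exist in both directions. Building this in avoids
  -- reversing paths and any appeal to connectedness; the potential is normalized separately at a
  -- representative of each class.
  let S : Setoid M :=
    { r := fun y z => T y z ∧ T z y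
      iseqv :=
        { refl := fun x => by
            obtain ⟨r, hr, C, -, -, h⟩ := Φ.exists_isParallelTransport_near x
            obtain ⟨P, hP, -⟩ := h x (mem_extChartAt_source x) x (mem_extChartAt_source x)
              (Metric.mem_ball_self hr) (Metric.mem_ball_self hr)
            exact ⟨⟨P, hP⟩, ⟨P, hP⟩⟩
          symm := fun h => ⟨h.2, h.1⟩
          trans := fun h h' => ⟨hT h.1 h'.1, hT h'.2 h.2⟩ } }
  let rep : M → M := fun y => (Quotient.mk S y).out
  have hrep (y : M) : T (rep y) y ∧ T y (rep y) := Quotient.mk_out (s := S) y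
  choose A hA using fun y => (hrep y).1
  choose B hB using fun y => (hrep y).2
  refine ⟨fun y => Real.log |LinearMap.det (Φ.coord (A y) : V →ₗ[ℝ] V)|, fun y z P Q hP hQ => ?_⟩
  have hyz : rep y = rep z := congrArg Quotient.out (Quotient.sound (s := S) ⟨⟨P, hP⟩, ⟨Q, hQ⟩⟩)
  -- Closing up `A'` and `A` followed by `P` with the same `B'` gives two loops of determinant one;
  -- comparing them gives the claim. The base points are generalized because the representatives are
  -- only propositionally equal.
  have key : ∀ (a b : M) (_ : a = b) (A : TangentSpace 𝓘(ℝ, E) a ≃ₗ[ℝ] TangentSpace 𝓘(ℝ, E) y)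
      (A' : TangentSpace 𝓘(ℝ, E) b ≃ₗ[ℝ] TangentSpace 𝓘(ℝ, E) z)
      (B' : TangentSpace 𝓘(ℝ, E) z ≃ₗ[ℝ] TangentSpace 𝓘(ℝ, E) b),
      IsParallelTransport cov A → IsParallelTransport cov A' → IsParallelTransport cov B' →
      Real.log |LinearMap.det (Φ.coord A' : V →ₗ[ℝ] V)|
        - Real.log |LinearMap.det (Φ.coord A : V →ₗ[ℝ] V)|
        = Real.log |LinearMap.det (Φ.coord P : V →ₗ[ℝ] V)| := by
    rintro a _ rfl A A' B' hA hA' hB'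
    have h1 := Φ.abs_det_coord_trans A' B'
    have h2 := Φ.abs_det_coord_trans (A.trans P) B'
    rw [hdet _ _ (hA'.trans _ _ hB'), abs_one, Real.log_one] at h1
    rw [hdet _ _ ((hA.trans _ _ hP).trans _ _ hB'), abs_one, Real.log_one,
      Φ.abs_det_coord_trans] at h2
    linarith
  exact key _ _ hyz _ _ _ (hA y) (hA z) (hB z)

/-- A maximum principle: the potential attains its maximum, its differential there is minus the
trace form read in the frame, and the trace form does not depend on the point. -/
theorem traceForm_eq_zero [FiniteDimensional ℝ V] [CompactSpace M] [Nonempty M]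
    (hdet : ∀ (x : M) (P : TangentSpace 𝓘(ℝ, E) x ≃ₗ[ℝ] TangentSpace 𝓘(ℝ, E) x),
      IsParallelTransport cov P → LinearMap.det (Φ.coord P : V →ₗ[ℝ] V) = 1) :
    Φ.traceForm = 0 := by
  obtain ⟨f, hf⟩ := Φ.exists_potential hdet
  have hloc (x : M) : ∃ r > 0, ∃ C,
      Metric.ball (extChartAt 𝓘(ℝ, E) x x) r ⊆ (extChartAt 𝓘(ℝ, E) x).target ∧
      (∀ z ∈ Metric.ball (extChartAt 𝓘(ℝ, E) x x) (3 * r), ‖Φ.inChartInv x z‖ ≤ C) ∧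
      ∀ y ∈ (extChartAt 𝓘(ℝ, E) x).source,
        extChartAt 𝓘(ℝ, E) x y ∈ Metric.ball (extChartAt 𝓘(ℝ, E) x x) r →
        ∃ ξ : ℝ, |ξ| ≤ 1 ∧ f y - f x = -Φ.traceForm (Φ.inChartInv x (extChartAt 𝓘(ℝ, E) x x
              + ξ • (extChartAt 𝓘(ℝ, E) x y - extChartAt 𝓘(ℝ, E) x x))
              (extChartAt 𝓘(ℝ, E) x y - extChartAt 𝓘(ℝ, E) x x)) := by
    obtain ⟨r, hr, C, h1, h2, h⟩ := Φ.exists_isParallelTransport_near x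
    refine ⟨r, hr, C, h1, h2, fun y hys hy => ?_⟩
    have hx := Metric.mem_ball_self (x := extChartAt 𝓘(ℝ, E) x x) hr
    obtain ⟨P, hP, ξ, hξ, hP'⟩ := h x (mem_extChartAt_source x) y hys hx hy
    obtain ⟨Q, hQ, -⟩ := h y hys x (mem_extChartAt_source x) hy hx
    refine ⟨ξ, hξ, ?_⟩
    rw [hf x y P Q hP hQ, hP', Real.abs_exp, Real.log_exp]
  have hcont : Continuous f := by
    rw [continuous_iff_continuousAt]
    intro x
    obtain ⟨r, hr, C, -, hC, h⟩ := hloc x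
    have hφ : ContinuousAt (fun y => extChartAt 𝓘(ℝ, E) x y) x :=
      continuousAt_extChartAt (I := 𝓘(ℝ, E)) x
    have hlim : Filter.Tendsto (fun y => ‖Φ.traceForm‖ * (C *
        ‖extChartAt 𝓘(ℝ, E) x y - extChartAt 𝓘(ℝ, E) x x‖)) (𝓝 x) (𝓝 0) := by
      have := ((hφ.sub_const (extChartAt 𝓘(ℝ, E) x x)).norm.const_mul C).const_mul ‖Φ.traceForm‖
      simpa [ContinuousAt] using this
    have hzero : Filter.Tendsto (fun y => f y - f x) (𝓝 x) (𝓝 0) := by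
      refine squeeze_zero_norm' ?_ hlim
      filter_upwards [extChartAt_source_mem_nhds (I := 𝓘(ℝ, E)) x,
        hφ.preimage_mem_nhds (Metric.ball_mem_nhds _ hr)] with y hys hy
      obtain ⟨ξ, hξ, e⟩ := h y hys hy
      rw [e, norm_neg]
      refine (Φ.traceForm.le_opNorm _).trans (mul_le_mul_of_nonneg_left
        ((ContinuousLinearMap.le_opNorm _ _).trans (mul_le_mul_of_nonneg_right
          (hC _ ?_) (norm_nonneg _))) (norm_nonneg _))
      rw [Metric.mem_ball, dist_eq_norm, add_sub_cancel_left, norm_smul]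
      have hy' : ‖extChartAt 𝓘(ℝ, E) x y - extChartAt 𝓘(ℝ, E) x x‖ < r := by
        rwa [← dist_eq_norm]
      exact (mul_le_of_le_one_left (norm_nonneg _) hξ).trans_lt (by linarith)
    exact tendsto_sub_nhds_zero_iff.1 hzero
  obtain ⟨x, -, hx⟩ := isCompact_univ.exists_isMaxOn univ_nonempty hcont.continuousOn
  obtain ⟨r, hr, C, htar, -, h⟩ := hloc x
  set a := extChartAt 𝓘(ℝ, E) x x with ha
  -- The potential need not be known to be differentiable. A negative value persists at nearby
  -- intermediate points, so by the mean value formula a short step in the direction `w` would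
  -- increase `f` beyond its maximum.
  have hnonneg (w : E) : 0 ≤ Φ.traceForm (Φ.inChartInv x a w) := by
    by_contra! hneg
    have hB : ContinuousAt (fun z => Φ.traceForm (Φ.inChartInv x z w)) a :=
      Φ.traceForm.continuous.continuousAt.comp
        ((Φ.hasFDerivAt_inChartInv x (mem_extChartAt_target (I := 𝓘(ℝ, E)) x)).continuousAt.clm_apply
          continuousAt_const)
    obtain ⟨ε, hε, hεn⟩ := Metric.eventually_nhds_iff_ball.1 (hB.eventually (gt_mem_nhds hneg))
    set s := min r ε / (‖w‖ + 1) with hs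
    have hs0 : 0 < s := by positivity
    have hsw : ‖s • w‖ < min r ε := by
      rw [norm_smul, Real.norm_of_nonneg hs0.le, hs, div_mul_eq_mul_div, div_lt_iff₀ (by positivity)]
      nlinarith [lt_min hr hε]
    have hmem : a + s • w ∈ Metric.ball a r := by
      rw [Metric.mem_ball, dist_eq_norm, add_sub_cancel_left]
      exact hsw.trans_le (min_le_left _ _)
    have hr' := (extChartAt 𝓘(ℝ, E) x).right_inv (htar hmem)
    obtain ⟨ξ, hξ, e⟩ := h ((extChartAt 𝓘(ℝ, E) x).symm (a + s • w))
      ((extChartAt 𝓘(ℝ, E) x).map_target (htar hmem)) (by rwa [hr'])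
    rw [hr', add_sub_cancel_left, map_smul, map_smul, smul_eq_mul] at e
    have hle := hx (mem_univ ((extChartAt 𝓘(ℝ, E) x).symm (a + s • w)))
    have hlt := hεn (a + ξ • s • w) (by
      rw [Metric.mem_ball, dist_eq_norm, add_sub_cancel_left, norm_smul]
      exact (mul_le_of_le_one_left (norm_nonneg _) hξ).trans_lt (hsw.trans_le (min_le_right _ _)))
    have hle' : f ((extChartAt 𝓘(ℝ, E) x).symm (a + s • w)) ≤ f x := hle
    nlinarith [mul_pos_of_neg_of_neg (neg_lt_zero.2 hs0) hlt]
  have hnonneg' (v : V) : 0 ≤ Φ.traceForm v := by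
    have h1 := hnonneg (Φ.frame x v)
    have h2 : Φ.inChartInv x a (Φ.frame x v) = v :=
      (Φ.inChartInv_self x (Φ.frame x v)).trans ((Φ.frame x).symm_apply_apply v)
    rwa [h2] at h1
  ext v
  have h := hnonneg' (-v)
  rw [map_neg] at h
  exact le_antisymm (neg_nonneg.1 h) (hnonneg' v)

end ConstantFrame
end ConstantFrame

/-! ### Left-invariant vector fields on `Γ \ G` -/

section LieGroup

variable {E : Type*} [NormedAddCommGroup E] [NormedSpace ℝ E]
  {G : Type*} [TopologicalSpace G] [ChartedSpace E G] [Group G] [LieGroup 𝓘(ℝ, E) ∞ G]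

/-- The field is the tangent map of multiplication applied to the zero vector at `g` and `v` at `1`,
hence a composition of smooth maps. -/
theorem contMDiff_infty_mulInvariantVectorField (v : GroupLieAlgebra 𝓘(ℝ, E) G) :
    ContMDiff 𝓘(ℝ, E) 𝓘(ℝ, E).tangent ∞
      (fun g : G => (⟨g, mulInvariantVectorField v g⟩ : TangentBundle 𝓘(ℝ, E) G)) := by
  let fg : G → TangentBundle 𝓘(ℝ, E) G := fun g => TotalSpace.mk' E g 0
  have sfg : ContMDiff 𝓘(ℝ, E) 𝓘(ℝ, E).tangent ∞ fg := contMDiff_zeroSection _ _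
  let fv : G → TangentBundle 𝓘(ℝ, E) G := fun _ => TotalSpace.mk' E 1 v
  have sfv : ContMDiff 𝓘(ℝ, E) 𝓘(ℝ, E).tangent ∞ fv := contMDiff_const
  have S₂ := (contMDiff_equivTangentBundleProd_symm (n := ∞) (I := 𝓘(ℝ, E)) (I' := 𝓘(ℝ, E))
    (M := G) (M' := G))
  have S₃ : ContMDiff (𝓘(ℝ, E).prod 𝓘(ℝ, E)).tangent 𝓘(ℝ, E).tangent ∞
      (tangentMap (𝓘(ℝ, E).prod 𝓘(ℝ, E)) 𝓘(ℝ, E) (fun p : G × G => p.1 * p.2)) :=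
    ContMDiff.contMDiff_tangentMap (contMDiff_mul 𝓘(ℝ, E) ∞) (m := ∞) (by simp)
  have S := (S₃.comp S₂).comp (sfg.prodMk sfv)
  convert! S with g
  · simp [fg, fv]
  · simp only [Function.comp_apply, tangentMap, fg, fv]
    rw [mfderiv_prod_eq_add_apply ((contMDiff_mul 𝓘(ℝ, E) ∞).mdifferentiableAt (by simp))]
    let L : E →L[ℝ] E := mfderiv 𝓘(ℝ, E) 𝓘(ℝ, E) (fun z : G => z * (1 : G)) g
    let R : E →L[ℝ] E := mfderiv 𝓘(ℝ, E) 𝓘(ℝ, E) (fun z : G => g * z) 1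
    let v' : E := v
    change R v' = L 0 + R v'
    rw [map_zero, zero_add]

end LieGroup

/-! ### Smoothness of the projection to the quotient -/

namespace LeftQuotient

theorem proj_mul_left {G : Type*} [Group G] (Γ : Subgroup G) {γ : G} (hγ : γ ∈ Γ) (g : G) : proj Γ (γ * g) = proj Γ g :=
  ((proj_eq_iff Γ).2 (by simpa using hγ)).symm

variable {E : Type*} [NormedAddCommGroup E] [NormedSpace ℝ E]
  {G : Type*} [TopologicalSpace G] [ChartedSpace E G] [Group G] [LieGroup 𝓘(ℝ, E) ∞ G]
  (Γ : Subgroup G) [DiscreteTopology Γ]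

/-- The projection `G → Γ \ G` has smooth local sections. -/
theorem exists_local_section (q : LeftQuotient Γ) :
    ∃ (a : G) (s : LeftQuotient Γ → G), proj Γ a = q ∧ s q = a ∧
      ContMDiffAt 𝓘(ℝ, E) 𝓘(ℝ, E) ∞ s q ∧ ContMDiffAt 𝓘(ℝ, E) 𝓘(ℝ, E) ∞ (proj Γ) a ∧
      (∀ᶠ y in 𝓝 q, proj Γ (s y) = y) ∧ ∀ᶠ g in 𝓝 a, s (proj Γ g) = g := by
  have : IsTopologicalGroup G := topologicalGroup_of_lieGroup 𝓘(ℝ, E) ∞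
  have hl := proj_isLocalHomeomorph Γ
  set a := (proj_surjective Γ).hasRightInverse.choose q with ha
  have haq : proj Γ a = q := (proj_surjective Γ).hasRightInverse.choose_spec q
  have hchart : chartAt E q = (hl.localInverseAt a).trans (chartAt E a) := rfl
  have hq : q ∈ (hl.localInverseAt a).source := by
    have := hl.apply_self_mem_localInverseAt_source (x := a)
    rwa [haq] at this
  have hsq : hl.localInverseAt a q = a := by
    have := hl.localInverseAt_apply_self (x := a)
    rwa [haq] at this
  have h1 : ∀ᶠ y in 𝓝 q, proj Γ (hl.localInverseAt a y) = y := by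
    filter_upwards [(hl.localInverseAt a).open_source.mem_nhds hq] with y hy
    exact hl.apply_localInverseAt_of_mem hy
  have h2 : ∀ᶠ g in 𝓝 a, hl.localInverseAt a (proj Γ g) = g := by
    filter_upwards [(hl.localInverseAt a).open_target.mem_nhds hl.self_mem_localInverseAt_target]
      with g hg
    have := (hl.localInverseAt a).right_inv hg
    rwa [hl.localInverseAt_symm] at this
  refine ⟨a, hl.localInverseAt a, haq, hsq, ?_, ?_, h1, h2⟩
  · have hc : ContMDiffAt 𝓘(ℝ, E) 𝓘(ℝ, E) ∞ (chartAt E q) q :=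
      (contMDiffOn_chart (I := 𝓘(ℝ, E)) q (mem_chart_source E q)).contMDiffAt
        ((chartAt E q).open_source.mem_nhds (mem_chart_source E q))
    have hqa : chartAt E q q = chartAt E a a := by
      rw [hchart]
      simp [hsq]
    have hc' : ContMDiffAt 𝓘(ℝ, E) 𝓘(ℝ, E) ∞ (chartAt E a).symm (chartAt E q q) := by
      rw [hqa]
      exact (contMDiffOn_chart_symm (I := 𝓘(ℝ, E)) _ (mem_chart_target E a)).contMDiffAt
        ((chartAt E a).open_target.mem_nhds (mem_chart_target E a))
    refine (ContMDiffAt.comp q hc' hc).congr_of_eventuallyEq ?_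
    filter_upwards [(chartAt E q).open_source.mem_nhds (mem_chart_source E q)] with y hy
    rw [hchart, OpenPartialHomeomorph.trans_source] at hy
    rw [hchart]
    exact ((chartAt E a).left_inv hy.2).symm
  · have hc : ContMDiffAt 𝓘(ℝ, E) 𝓘(ℝ, E) ∞ (chartAt E a) a :=
      (contMDiffOn_chart (I := 𝓘(ℝ, E)) a (mem_chart_source E a)).contMDiffAt
        ((chartAt E a).open_source.mem_nhds (mem_chart_source E a))
    have hqa : chartAt E a a = chartAt E q q := by
      rw [hchart]
      simp [hsq]
    have hc' : ContMDiffAt 𝓘(ℝ, E) 𝓘(ℝ, E) ∞ (chartAt E q).symm (chartAt E a a) := by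
      rw [hqa]
      exact (contMDiffOn_chart_symm (I := 𝓘(ℝ, E)) _ (mem_chart_target E q)).contMDiffAt
        ((chartAt E q).open_target.mem_nhds (mem_chart_target E q))
    refine (ContMDiffAt.comp a hc' hc).congr_of_eventuallyEq ?_
    filter_upwards [(chartAt E a).open_source.mem_nhds (mem_chart_source E a)] with g hg
    rw [hchart]
    simp [(chartAt E a).left_inv hg]

/-- The charts give smoothness only at the chosen preimage `a` of each point; left translation by `a
* g⁻¹ ∈ Γ` moves any other preimage `g` there without changing the projection. -/
theorem contMDiff_proj : ContMDiff 𝓘(ℝ, E) 𝓘(ℝ, E) ∞ (proj Γ : G → LeftQuotient Γ) := by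
  intro g
  obtain ⟨a, s, ha, -, -, hp, -⟩ := exists_local_section (E := E) Γ (proj Γ g)
  have hγ : a * g⁻¹ ∈ Γ := (proj_eq_iff Γ).1 ha.symm
  have hm : ContMDiffAt 𝓘(ℝ, E) 𝓘(ℝ, E) ∞ (fun h => a * g⁻¹ * h) g :=
    contMDiff_mul_left.contMDiffAt
  have hp' : ContMDiffAt 𝓘(ℝ, E) 𝓘(ℝ, E) ∞ (proj Γ) (a * g⁻¹ * g) := by
    rwa [inv_mul_cancel_right]
  refine (ContMDiffAt.comp g hp' hm).congr_of_eventuallyEq (Filter.Eventually.of_forall fun h => ?_)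
  exact (proj_mul_left Γ hγ h).symm

end LeftQuotient

/-! ### The global frame of left-invariant fields and its brackets -/

namespace LeftQuotient

variable {E : Type*} [NormedAddCommGroup E] [NormedSpace ℝ E]
  {G : Type*} [TopologicalSpace G] [ChartedSpace E G] [Group G] [LieGroup 𝓘(ℝ, E) ∞ G]
  (Γ : Subgroup G) [DiscreteTopology Γ]

/-- The left-invariant fields at a point of `Γ \ G`, as a linear map on the model space. -/
noncomputable def frameMap (g : G) : E →L[ℝ] E :=
  mfderiv 𝓘(ℝ, E) 𝓘(ℝ, E) (fun h => proj Γ (g * h)) (1 : G)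

theorem frameMap_apply (g : G) (v : GroupLieAlgebra 𝓘(ℝ, E) G) :
    frameMap (E := E) Γ g v = invariantVector Γ v g := by
  have hm : MDifferentiableAt 𝓘(ℝ, E) 𝓘(ℝ, E) (fun h => g * h) (1 : G) :=
    (contMDiff_mul_left (n := ∞)).mdifferentiable (by simp) 1
  have hp : MDifferentiableAt 𝓘(ℝ, E) 𝓘(ℝ, E) (proj Γ) (g * 1) :=
    (contMDiff_proj Γ).mdifferentiable (by simp) (g * 1)
  let D (g' : G) : E →L[ℝ] E := mfderiv 𝓘(ℝ, E) 𝓘(ℝ, E) (proj Γ) g'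
  exact (mfderiv_comp_apply (1 : G) hp hm v).trans
    (DFunLike.congr_fun (congrArg D (mul_one g)) (mulInvariantVectorField v g : E))

/-- Left translation by `Γ` commutes with right multiplication, so the whole orbit map `h ↦ Γ g h`
depends only on `Γ g`. This is why left-invariant fields descend. -/
theorem frameMap_congr {g g' : G} (h : proj Γ g = proj Γ g') :
    (frameMap Γ g : E →L[ℝ] E) = frameMap Γ g' := by
  have : (fun h => proj Γ (g * h)) = fun h => proj Γ (g' * h) := by
    ext k
    rw [proj_eq_iff] at h ⊢
    simpa using h
  simp only [frameMap]
  rw [this]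

theorem injective_frameMap (g : G) : Function.Injective (frameMap Γ g : E →L[ℝ] E) := by
  obtain ⟨a, s, ha, hsa, hs, hp, hps, hsp⟩ := exists_local_section (E := E) Γ (proj Γ g)
  rw [← frameMap_congr Γ ha]
  rw [← ha] at hs hsa
  have hf : ContMDiff 𝓘(ℝ, E) 𝓘(ℝ, E) ∞ (fun h => proj Γ (a * h)) :=
    (contMDiff_proj Γ).comp contMDiff_mul_left
  have hs' : ContMDiffAt 𝓘(ℝ, E) 𝓘(ℝ, E) ∞ (fun y => a⁻¹ * s y) (proj Γ (a * 1)) := by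
    rw [mul_one]
    exact ContMDiffAt.comp _ (g := fun y => a⁻¹ * y) contMDiff_mul_left.contMDiffAt hs
  -- A local section translated by `a⁻¹` inverts the orbit map near `1`; the chain rule turns this
  -- into a left inverse of `frameMap`.
  have hid : (fun y => a⁻¹ * s y) ∘ (fun h => proj Γ (a * h)) =ᶠ[𝓝 1] id := by
    have hc : Filter.Tendsto (fun h => a * h) (𝓝 1) (𝓝 a) := by
      have : ContMDiff 𝓘(ℝ, E) 𝓘(ℝ, E) ∞ (fun h : G => a * h) := contMDiff_mul_left
      simpa using this.continuous.tendsto 1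
    filter_upwards [hc.eventually hsp] with h hh
    simp [hh]
  have hcomp := mfderiv_comp (I' := 𝓘(ℝ, E)) (1 : G)
    (hs'.mdifferentiableAt (by simp)) (hf.mdifferentiable (by simp) 1)
  rw [hid.mfderiv_eq, mfderiv_id] at hcomp
  let L : E →L[ℝ] E := mfderiv 𝓘(ℝ, E) 𝓘(ℝ, E) (fun y => a⁻¹ * s y) (proj Γ (a * 1))
  exact Function.LeftInverse.injective (g := L) fun v => (DFunLike.congr_fun hcomp v).symm

theorem isInvertible_mfderiv_proj [FiniteDimensional ℝ E] (g : G) :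
    (mfderiv 𝓘(ℝ, E) 𝓘(ℝ, E) (proj Γ) g).IsInvertible := by
  let D : E →L[ℝ] E := mfderiv 𝓘(ℝ, E) 𝓘(ℝ, E) (proj Γ) g
  have hsurj : Function.Surjective D := by
    intro w
    obtain ⟨v, hv⟩ := (LinearMap.injective_iff_surjective
      (f := (frameMap Γ g : E →L[ℝ] E).toLinearMap)).1 (injective_frameMap Γ g) w
    exact ⟨mulInvariantVectorField (v : GroupLieAlgebra 𝓘(ℝ, E) G) g,
      (frameMap_apply Γ g v).symm.trans hv⟩
  have hinj : Function.Injective D := (LinearMap.injective_iff_surjective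
      (f := D.toLinearMap)).2 hsurj
  let e : E ≃L[ℝ] E := (LinearEquiv.ofBijective D.toLinearMap ⟨hinj, hsurj⟩).toContinuousLinearEquiv
  have : D.IsInvertible := ⟨e, by ext v; rfl⟩
  exact this

/-- The frame of left-invariant vector fields on `Γ \ G`. -/
noncomputable def invariantFrame [FiniteDimensional ℝ E] (q : LeftQuotient Γ) :
    E ≃L[ℝ] TangentSpace 𝓘(ℝ, E) q :=
  (LinearEquiv.ofInjectiveEndo (frameMap Γ q.out : E →L[ℝ] E).toLinearMap
    (injective_frameMap Γ q.out)).toContinuousLinearEquiv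

theorem invariantFrame_proj [FiniteDimensional ℝ E] (g : G) (v : GroupLieAlgebra 𝓘(ℝ, E) G) :
    invariantFrame (E := E) Γ (proj Γ g) v = invariantVector Γ v g := by
  refine Eq.trans ?_ (frameMap_apply Γ g v)
  exact DFunLike.congr_fun (frameMap_congr (E := E) Γ (Quotient.out_eq (proj Γ g))) (v : E)

theorem contMDiff_invariantFrame [FiniteDimensional ℝ E] (v : E) :
    ContMDiff 𝓘(ℝ, E) 𝓘(ℝ, E).tangent ∞
      (T% (fun q : LeftQuotient Γ => invariantFrame Γ q v)) := by
  intro q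
  obtain ⟨a, s, ha, hsa, hs, hp, hps, hsp⟩ := exists_local_section (E := E) Γ q
  have ht : ContMDiff 𝓘(ℝ, E).tangent 𝓘(ℝ, E).tangent ∞
      (tangentMap 𝓘(ℝ, E) 𝓘(ℝ, E) (proj Γ : G → LeftQuotient Γ)) :=
    (contMDiff_proj Γ).contMDiff_tangentMap (m := ∞) (by simp)
  have h := (ht.comp (contMDiff_infty_mulInvariantVectorField
    (v : GroupLieAlgebra 𝓘(ℝ, E) G))).contMDiffAt.comp q hs
  refine h.congr_of_eventuallyEq ?_
  filter_upwards [hps] with y hy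
  have hfr (y' : LeftQuotient Γ) (g : G) (h : proj Γ g = y') :
      (⟨y', invariantFrame Γ y' v⟩ : TangentBundle 𝓘(ℝ, E) (LeftQuotient Γ))
        = ⟨proj Γ g, invariantVector Γ (v : GroupLieAlgebra 𝓘(ℝ, E) G) g⟩ := by
    subst h
    exact congrArg (TotalSpace.mk' E (proj Γ g)) (invariantFrame_proj Γ g v)
  exact hfr y (s y) hy

theorem mpullback_invariantFrame [FiniteDimensional ℝ E] (v : GroupLieAlgebra 𝓘(ℝ, E) G) :
    VectorField.mpullback 𝓘(ℝ, E) 𝓘(ℝ, E) (proj Γ) (fun q => invariantFrame (E := E) Γ q v)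
      = mulInvariantVectorField v := by
  ext g
  rw [VectorField.mpullback_apply, invariantFrame_proj]
  obtain ⟨e, he⟩ := isInvertible_mfderiv_proj (E := E) Γ g
  rw [invariantVector, ← he, ContinuousLinearMap.inverse_equiv]
  exact e.symm_apply_apply _

/-- The projection is a local diffeomorphism pulling the frame back to left-invariant fields, and
pullback commutes with brackets. -/
theorem mlieBracket_invariantFrame [FiniteDimensional ℝ E] (v w : GroupLieAlgebra 𝓘(ℝ, E) G)
    (q : LeftQuotient Γ) :
    VectorField.mlieBracket 𝓘(ℝ, E) (fun q => invariantFrame (E := E) Γ q v)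
      (fun q => invariantFrame (E := E) Γ q w) q = invariantFrame (E := E) Γ q (⁅v, w⁆ : GroupLieAlgebra 𝓘(ℝ, E) G) := by
  have := FiniteDimensional.complete ℝ E
  have h2 : minSmoothness ℝ 2 ≤ (∞ : WithTop ℕ∞) := by
    simpa using (ENat.LEInfty.out : (2 : WithTop ℕ∞) ≤ ∞)
  have : LieGroup 𝓘(ℝ, E) (minSmoothness ℝ 3) G :=
    LieGroup.of_le (n := ∞) (by simpa using (ENat.LEInfty.out : (3 : WithTop ℕ∞) ≤ ∞))
  have : IsManifold 𝓘(ℝ, E) (minSmoothness ℝ 2) (LeftQuotient Γ) :=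
    IsManifold.of_le (n := ∞) h2
  have : IsManifold 𝓘(ℝ, E) (minSmoothness ℝ 2) G := IsManifold.of_le (n := ∞) h2
  obtain ⟨g, rfl⟩ := proj_surjective Γ q
  have hd (v : E) := (contMDiff_invariantFrame Γ v).mdifferentiable (by simp) (proj Γ g)
  have h := VectorField.mpullback_mlieBracket (n := ∞) (hd v) (hd w)
    (contMDiff_proj Γ).contMDiffAt h2
  rw [mpullback_invariantFrame, mpullback_invariantFrame, ← mulInvariantVector_mlieBracket,
    ← GroupLieAlgebra.bracket_def, VectorField.mpullback_apply] at h
  rw [invariantFrame_proj, invariantVector, ← h]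
  exact ((isInvertible_mfderiv_proj Γ g).self_apply_inverse _).symm

end LeftQuotient

section ConstantFrame

variable {E : Type*} [NormedAddCommGroup E] [NormedSpace ℝ E]
  {M : Type*} [TopologicalSpace M] [ChartedSpace E M] [IsManifold 𝓘(ℝ, E) ∞ M]

namespace ConstantFrame

variable {V : Type*} [NormedAddCommGroup V] [NormedSpace ℝ V]

/-- A global frame in which the connection has constant coefficients at all points is a
`ConstantFrame`: the coefficients are automatically bilinear. -/
noncomputable def ofConstant [FiniteDimensional ℝ V] [Nonempty M]
    {cov : CovariantDerivative 𝓘(ℝ, E) E (TangentSpace 𝓘(ℝ, E) : M → Type _)}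
    (frame : ∀ x : M, V ≃L[ℝ] TangentSpace 𝓘(ℝ, E) x)
    (contMDiff : ∀ v : V, ContMDiff 𝓘(ℝ, E) 𝓘(ℝ, E).tangent ∞ (T% (fun x : M => frame x v)))
    (b : V → V → V)
    (hb : ∀ (v w : V) (x : M), cov (fun y => frame y w) x (frame x v) = frame x (b v w)) :
    ConstantFrame V cov where
  frame := frame
  contMDiff := contMDiff
  conn := LinearMap.toContinuousLinearMap
    { toFun := fun v => LinearMap.toContinuousLinearMap
        { toFun := fun w => b v w
          map_add' := fun w w' => by
            let x : M := Classical.arbitrary M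
            apply (frame x).injective
            have e : (fun y => frame y (w + w'))
                = (fun y => frame y w) + fun y => frame y w' := by ext y; simp
            rw [map_add, ← hb, ← hb, ← hb, e, cov.isCovariantDerivativeOnUniv.add
              ((contMDiff w).mdifferentiable (by simp) x)
              ((contMDiff w').mdifferentiable (by simp) x)]
            rfl
          map_smul' := fun a w => by
            let x : M := Classical.arbitrary M
            apply (frame x).injective
            have e : (fun y => frame y (a • w)) = a • fun y => frame y w := by ext y; simp
            rw [map_smul, ← hb, ← hb, e, cov.isCovariantDerivativeOnUniv.smul_const a
              ((contMDiff w).mdifferentiable (by simp) x)]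
            rfl }
      map_add' := fun v v' => by
        ext w
        let x : M := Classical.arbitrary M
        apply (frame x).injective
        simp [← hb]
      map_smul' := fun a v => by
        ext w
        let x : M := Classical.arbitrary M
        apply (frame x).injective
        simp [← hb] }
  cov_frame := hb

end ConstantFrame
end ConstantFrame

namespace LeftQuotient

variable {E : Type*} [NormedAddCommGroup E] [NormedSpace ℝ E] [FiniteDimensional ℝ E]
  {G : Type*} [TopologicalSpace G] [ChartedSpace E G] [Group G] [LieGroup 𝓘(ℝ, E) ∞ G]
  {Γ : Subgroup G} [DiscreteTopology Γ]

theorem IsInvariantStructure.exists_coeff {A : ComplexStructure E (LeftQuotient Γ)}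
    (hA : IsInvariantStructure A) :
    ∃ a : E →L[ℝ] E, ∀ (q : LeftQuotient Γ) (v : E),
      A q (invariantFrame Γ q v) = invariantFrame Γ q (a v) := by
  obtain ⟨a, ha⟩ := hA
  refine ⟨a, fun q v => ?_⟩
  obtain ⟨g, rfl⟩ := proj_surjective Γ q
  exact (congrArg (A (proj Γ g)) (invariantFrame_proj Γ g v)).trans
    ((ha g v).trans (invariantFrame_proj Γ g (a v)).symm)

end LeftQuotient

/-! ### Hypercomplex structures with constant coefficients in a frame -/

section ConstantFrame

variable {E : Type*} [NormedAddCommGroup E] [NormedSpace ℝ E]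
  {M : Type*} [TopologicalSpace M] [ChartedSpace E M] [IsManifold 𝓘(ℝ, E) ∞ M]
  {V : Type*} [NormedAddCommGroup V] [NormedSpace ℝ V]

namespace ConstantFrame

variable {cov : CovariantDerivative 𝓘(ℝ, E) E (TangentSpace 𝓘(ℝ, E) : M → Type _)}
  (Φ : ConstantFrame V cov)

theorem linearMap_det_coord {x : M} (P : TangentSpace 𝓘(ℝ, E) x ≃ₗ[ℝ] TangentSpace 𝓘(ℝ, E) x) :
    LinearMap.det (Φ.coord P : V →ₗ[ℝ] V) = LinearEquiv.det P := by
  rw [LinearEquiv.coe_det]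
  exact LinearMap.det_conj (P : TangentSpace 𝓘(ℝ, E) x →ₗ[ℝ] TangentSpace 𝓘(ℝ, E) x)
    (Φ.frame x).symm.toLinearEquiv

theorem coord_comm_iff {x : M} {P : TangentSpace 𝓘(ℝ, E) x ≃ₗ[ℝ] TangentSpace 𝓘(ℝ, E) x}
    {A : TangentSpace 𝓘(ℝ, E) x →L[ℝ] TangentSpace 𝓘(ℝ, E) x} {a : V →L[ℝ] V}
    (hA : ∀ v, A (Φ.frame x v) = Φ.frame x (a v)) (h : ∀ v, Φ.coord P (a v) = a (Φ.coord P v))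
    (v : TangentSpace 𝓘(ℝ, E) x) : P (A v) = A (P v) := by
  obtain ⟨u, rfl⟩ := (Φ.frame x).surjective v
  rw [hA, ← Φ.frame_coord, h, ← hA, Φ.frame_coord]

/-- Complex linearity of a form in each argument may be tested in the frame. -/
theorem update_eq_iff {k : ℕ} {x : M} {A : TangentSpace 𝓘(ℝ, E) x →L[ℝ] TangentSpace 𝓘(ℝ, E) x}
    {a : V →L[ℝ] V} (hA : ∀ v, A (Φ.frame x v) = Φ.frame x (a v))
    (β : TangentSpace 𝓘(ℝ, E) x [⋀^Fin k]→L[ℝ] ℂ) :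
    (∀ v l, β (Function.update v l (A (v l))) = Complex.I * β v) ↔
      ∀ (v : Fin k → V) l, β (fun m => Φ.frame x (Function.update v l (a (v l)) m))
        = Complex.I * β fun m => Φ.frame x (v m) := by
  have e (v : Fin k → V) (l) : (fun m => Φ.frame x (Function.update v l (a (v l)) m))
      = Function.update (fun m => Φ.frame x (v m)) l (A (Φ.frame x (v l))) := by
    ext m
    rw [hA]
    rcases eq_or_ne m l with rfl | h
    · simp
    · simp [h]
  simp only [e]
  refine ⟨fun h v l => h (fun m => Φ.frame x (v m)) l, fun h v l => ?_⟩
  obtain ⟨u, rfl⟩ : ∃ u : Fin k → V, v = fun m => Φ.frame x (u m) :=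
    ⟨fun m => (Φ.frame x).symm (v m), by simp⟩
  exact h u l

/-- Parallelism of `A` evaluated on a frame field, at any one point. -/
theorem conn_comm {A : ∀ x : M, TangentSpace 𝓘(ℝ, E) x →L[ℝ] TangentSpace 𝓘(ℝ, E) x}
    (hcov : ∀ (Y : ∀ x : M, TangentSpace 𝓘(ℝ, E) x) (x : M), MDiffAt (T% Y) x →
      ∀ v, cov (fun y => A y (Y y)) x v = A x (cov Y x v)) [Nonempty M]
    {a : V →L[ℝ] V} (hA : ∀ x v, A x (Φ.frame x v) = Φ.frame x (a v)) (v w : V) :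
    Φ.conn v (a w) = a (Φ.conn v w) := by
  let x : M := Classical.arbitrary M
  have h := hcov (fun y => Φ.frame y w) x (Φ.mdifferentiableAt x w) (Φ.frame x v)
  simp only [hA] at h
  rw [Φ.cov_frame, Φ.cov_frame, hA] at h
  exact (Φ.frame x).injective h

end ConstantFrame

/-- A hypercomplex structure together with a frame in which the structure and the Obata connection
have constant coefficients. -/
structure HypercomplexFrame [FiniteDimensional ℝ E] (V : Type*) [NormedAddCommGroup V]
    [NormedSpace ℝ V] (H : HypercomplexStructure E M) extends ConstantFrame V H.obata where
  i : V →L[ℝ] V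
  j : V →L[ℝ] V
  k : V →L[ℝ] V
  I_frame : ∀ x v, H.I x (frame x v) = frame x (i v)
  J_frame : ∀ x v, H.J x (frame x v) = frame x (j v)
  K_frame : ∀ x v, H.K x (frame x v) = frame x (k v)

namespace HypercomplexFrame

variable [FiniteDimensional ℝ E] {H : HypercomplexStructure E M} (Φ : HypercomplexFrame V H)

section

variable [Nonempty M]

theorem conn_i (v w : V) : Φ.conn v (Φ.i w) = Φ.i (Φ.conn v w) :=
  Φ.conn_comm H.isObata_obata.parallel_I Φ.I_frame v w

theorem conn_j (v w : V) : Φ.conn v (Φ.j w) = Φ.j (Φ.conn v w) :=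
  Φ.conn_comm H.isObata_obata.parallel_J Φ.J_frame v w

theorem conn_k (v w : V) : Φ.conn v (Φ.k w) = Φ.k (Φ.conn v w) :=
  Φ.conn_comm H.isObata_obata.parallel_K Φ.K_frame v w

theorem i_i (v : V) : Φ.i (Φ.i v) = -v := by
  let x : M := Classical.arbitrary M
  apply (Φ.frame x).injective
  rw [← Φ.I_frame, ← Φ.I_frame, H.I.sq, map_neg]

theorem j_j (v : V) : Φ.j (Φ.j v) = -v := by
  let x : M := Classical.arbitrary M
  apply (Φ.frame x).injective
  rw [← Φ.J_frame, ← Φ.J_frame, H.J.sq, map_neg]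

theorem j_i (v : V) : Φ.j (Φ.i v) = -Φ.i (Φ.j v) := by
  let x : M := Classical.arbitrary M
  apply (Φ.frame x).injective
  rw [← Φ.J_frame, ← Φ.I_frame, H.J_I, map_neg, ← Φ.I_frame, ← Φ.J_frame]

theorem sum_update_conn [FiniteDimensional ℝ V] {n : ℕ} (hV : Module.finrank ℝ V = 2 * n)
    {α : V [⋀^Fin n]→L[ℝ] ℂ}
    (hα : ∀ v k, α (Function.update v k (Φ.i (v k))) = Complex.I * α v) (w : V) (v : Fin n → V) :
    ∑ l, α (Function.update v l (Φ.conn w (v l)))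
      = ((LinearMap.trace ℝ V (Φ.conn w).toLinearMap / 2 : ℝ) : ℂ) * α v :=
  AlternatingMap.sum_update_eq_half_trace_mul (i := Φ.i.toLinearMap) (j := Φ.j.toLinearMap)
    (N := (Φ.conn w).toLinearMap) Φ.i_i hV Φ.j_j Φ.j_i (Φ.conn_i w) (Φ.conn_j w)
    α.toAlternatingMap hα v

end

theorem holonomyGroup_le_SL [FiniteDimensional ℝ V] (hτ : Φ.traceForm = 0) (x : M) :
    holonomyGroup H.obata x ≤ H.SL x := by
  have : Nonempty M := ⟨x⟩
  refine (Subgroup.closure_le _).2 fun P hP => ⟨?_, ?_, ?_, ?_⟩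
  · exact Φ.coord_comm_iff (Φ.I_frame x) (Φ.coord_comm Φ.conn_i hP)
  · exact Φ.coord_comm_iff (Φ.J_frame x) (Φ.coord_comm Φ.conn_j hP)
  · exact Φ.coord_comm_iff (Φ.K_frame x) (Φ.coord_comm Φ.conn_k hP)
  · ext
    rw [← Φ.linearMap_det_coord]
    exact Φ.det_coord_eq_one (fun v => DFunLike.congr_fun hτ v) hP

theorem traceForm_eq_zero_of_holonomyGroup_le [FiniteDimensional ℝ V] [CompactSpace M] [Nonempty M]
    (h : ∀ x, holonomyGroup H.obata x ≤ H.SL x) : Φ.traceForm = 0 := by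
  refine Φ.traceForm_eq_zero fun x P hP => ?_
  rw [Φ.linearMap_det_coord, (h x (Subgroup.subset_closure hP)).2.2.2, Units.val_one]

/-- This is `dη = -(τ/2) ∧ η`, with `τ` the trace form. -/
theorem d_apply [FiniteDimensional ℝ V] [Nonempty M] {n : ℕ} (hV : Module.finrank ℝ V = 2 * n)
    {η : ComplexForm E M n} {α : V [⋀^Fin n]→L[ℝ] ℂ} (h : ConstantFrame.FormHasCoeff Φ.toConstantFrame η α)
    (hα : ∀ v k, α (Function.update v k (Φ.i (v k))) = Complex.I * α v)
    (x : M) (v : Fin (n + 1) → V) :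
    η.d x (fun m => Φ.frame x (v m)) = -∑ m : Fin (n + 1), (-1 : ℤ) ^ (m : ℕ) •
      (((Φ.traceForm (v m) / 2 : ℝ) : ℂ) * α (m.removeNth v)) := by
  rw [h.d_apply H.isObata_obata.torsion_eq_zero]
  congr 1
  exact Finset.sum_congr rfl fun m _ => congrArg _ (Φ.sum_update_conn hV hα _ _)

theorem isTypeZero_iff [Nonempty M] {k : ℕ} {η : ComplexForm E M k} {α : V [⋀^Fin k]→L[ℝ] ℂ}
    (h : ConstantFrame.FormHasCoeff Φ.toConstantFrame η α) :
    η.IsTypeZero H.I ↔ ∀ v l, α (Function.update v l (Φ.i (v l))) = Complex.I * α v := by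
  have e (x : M) := Φ.update_eq_iff (Φ.I_frame x) (η x)
  have e' (x : M) (v : Fin k → V) (l) : (η x (fun m =>
      Φ.frame x (Function.update v l (Φ.i (v l)) m)) = Complex.I * η x fun m => Φ.frame x (v m))
      ↔ α (Function.update v l (Φ.i (v l))) = Complex.I * α v := by
    rw [h x, h x]
  refine ⟨fun hη v l => (e' (Classical.arbitrary M) v l).1 ((e _).1 (hη _) v l),
    fun hα x => (e x).2 fun v l => (e' x v l).2 (hα v l)⟩

theorem exists_isHolomorphic [FiniteDimensional ℝ V] [Nonempty M] {n : ℕ}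
    (hV : Module.finrank ℝ V = 2 * n) (hτ : Φ.traceForm = 0) :
    ∃ (η : ComplexForm E M n) (α : V [⋀^Fin n]→L[ℝ] ℂ),
      η.IsHolomorphic H.I ∧ (∀ x, η x ≠ 0) ∧ ConstantFrame.FormHasCoeff Φ.toConstantFrame η α := by
  obtain ⟨α, hα0, hα⟩ := ContinuousAlternatingMap.exists_ne_zero_of_complexStructure hV
    (i := Φ.i.toLinearMap) Φ.i_i
  let η : ComplexForm E M n := fun x =>
    α.compContinuousLinearMap (Φ.frame x).symm.toContinuousLinearMap
  have h : ConstantFrame.FormHasCoeff Φ.toConstantFrame η α := fun x v => by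
    change α (fun m => (Φ.frame x).symm (Φ.frame x (v m))) = α v
    simp
  refine ⟨η, α, ⟨h.isSmooth, (Φ.isTypeZero_iff h).2 hα, fun x => ?_⟩, fun x hx => hα0 ?_, h⟩
  · refine (Φ.update_eq_iff (Φ.I_frame x) (η.d x)).2 fun v l => ?_
    rw [Φ.d_apply hV h hα, Φ.d_apply hV h hα]
    simp [hτ]
  · ext v
    rw [← h x v, hx]
    rfl

/-- Since `dη = -(τ/2) ∧ η`, type `(n + 1, 0)` forces `τ` to be complex linear wherever `η` is
nonzero; a real-valued form with that property vanishes. -/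
theorem traceForm_eq_zero_of_isHolomorphic [FiniteDimensional ℝ V] {n : ℕ}
    (hV : Module.finrank ℝ V = 2 * n) {η : ComplexForm E M n} {α : V [⋀^Fin n]→L[ℝ] ℂ}
    (hη : η.IsHolomorphic H.I) (h : ConstantFrame.FormHasCoeff Φ.toConstantFrame η α) {x : M} (hx : η x ≠ 0) :
    Φ.traceForm = 0 := by
  have : Nonempty M := ⟨x⟩
  have hα := (Φ.isTypeZero_iff h).1 hη.type_zero
  obtain ⟨u, hu⟩ : ∃ u, α u ≠ 0 := by
    by_contra! h0
    apply hx
    ext v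
    have := h x fun m => (Φ.frame x).symm (v m)
    simpa [h0] using this
  ext w
  let v : Fin (n + 1) → V := Fin.cons w u
  have hd := (Φ.update_eq_iff (Φ.I_frame x) (η.d x)).1 (hη.dbar_eq_zero x) v 0
  -- Complex linearity of `dη` is tested in slot `0`. In the summands other than `0` this slot is an
  -- argument of `α`, which is already complex linear, so they cancel; the remaining one compares `τ
  -- (i w)` with `Complex.I * τ w`.
  rw [Φ.d_apply hV h hα, Φ.d_apply hV h hα, mul_neg, neg_inj, Finset.mul_sum, ← sub_eq_zero,
    ← Finset.sum_sub_distrib, Finset.sum_eq_single 0] at hd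
  · rw [Function.update_self, Fin.removeNth_update] at hd
    have hv : Fin.removeNth 0 v = u := rfl
    have hv0 : v 0 = w := rfl
    rw [hv, hv0] at hd
    simp only [Fin.val_zero, pow_zero, one_smul] at hd
    have hd' : (((Φ.traceForm (Φ.i w) / 2 : ℝ) : ℂ)
        - Complex.I * ((Φ.traceForm w / 2 : ℝ) : ℂ)) * α u = 0 := by
      rw [← hd]; ring
    -- Both values of `τ` are real, so the imaginary part isolates `τ w`.
    have him := congrArg Complex.im ((mul_eq_zero.1 hd').resolve_right hu)
    simpa using him
  · intro p _ hp
    obtain ⟨l, hl⟩ := Fin.exists_succAbove_eq hp.symm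
    rw [Function.update_of_ne hp, ← hl, Fin.removeNth_update_succAbove, hl]
    have : Fin.removeNth p v l = v 0 := by rw [Fin.removeNth, hl]
    rw [← this, hα]
    simp only [zsmul_eq_mul]
    ring
  · simp

end HypercomplexFrame
end ConstantFrame

/-! ### Invariant hypercomplex structures on the quotient, and the theorem -/

namespace LeftQuotient

variable {E : Type*} [NormedAddCommGroup E] [NormedSpace ℝ E] [FiniteDimensional ℝ E]
  {G : Type*} [TopologicalSpace G] [ChartedSpace E G] [Group G] [LieGroup 𝓘(ℝ, E) ∞ G]
  {Γ : Subgroup G} [DiscreteTopology Γ]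

/-- On left-invariant fields the Obata formula contains only brackets of left-invariant fields and
the constant maps `i`, `j`, `k`, so its coefficients are constant. -/
theorem exists_hypercomplexFrame (H : HypercomplexStructure E (LeftQuotient Γ))
    (hH : IsInvariantHypercomplex H) :
    ∃ Φ : HypercomplexFrame E H, Φ.frame = invariantFrame Γ := by
  obtain ⟨⟨i, hi⟩, ⟨j, hj⟩, ⟨k, hk⟩⟩ :=
    And.imp (·.exists_coeff) (And.imp (·.exists_coeff) (·.exists_coeff)) hH
  let b : E → E → E := (Bracket.bracket : GroupLieAlgebra 𝓘(ℝ, E) G →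
    GroupLieAlgebra 𝓘(ℝ, E) G → GroupLieAlgebra 𝓘(ℝ, E) G)
  have hb (v w : E) (q : LeftQuotient Γ) :
      VectorField.mlieBracket 𝓘(ℝ, E) (fun q => invariantFrame Γ q v)
        (fun q => invariantFrame Γ q w) q = invariantFrame Γ q (b v w) :=
    mlieBracket_invariantFrame Γ v w q
  have : Nonempty (LeftQuotient Γ) := ⟨proj Γ 1⟩
  refine ⟨{
    toConstantFrame := ConstantFrame.ofConstant (invariantFrame Γ) (contMDiff_invariantFrame Γ)
      (fun v w => (1 / 2 : ℝ) • (b v w + i (b (i v) w) - j (b v (j w)) + k (b (i v) (j w))))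
      (fun v w q => ?_)
    i := i
    j := j
    k := k
    I_frame := hi
    J_frame := hj
    K_frame := hk }, rfl⟩
  rw [H.obata_apply (X := fun q => invariantFrame Γ q v)
    ((contMDiff_invariantFrame Γ v).mdifferentiable (by simp) q)]
  simp only [HypercomplexStructure.obataAux, hi, hj, hb, hk]
  simp

theorem isInvariantForm_iff
    {cov : CovariantDerivative 𝓘(ℝ, E) E (TangentSpace 𝓘(ℝ, E) : LeftQuotient Γ → Type _)}
    {Φ : ConstantFrame E cov} (hΦ : Φ.frame = invariantFrame Γ) {k : ℕ}
    {η : ComplexForm E (LeftQuotient Γ) k} :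
    IsInvariantForm η ↔ ∃ α : E [⋀^Fin k]→L[ℝ] ℂ, Φ.FormHasCoeff η α := by
  have e (g : G) (v : Fin k → E) : (fun m => Φ.frame (proj Γ g) (v m))
      = fun m => invariantVector Γ (v m) g := by
    ext m
    rw [hΦ]
    exact invariantFrame_proj Γ g (v m)
  constructor
  · rintro ⟨α, hα⟩
    refine ⟨α, fun q v => ?_⟩
    obtain ⟨g, rfl⟩ := proj_surjective Γ q
    exact (congrArg (η (proj Γ g)) (e g v)).trans (hα g v)
  · rintro ⟨α, hα⟩
    exact ⟨α, fun g v => (congrArg (η (proj Γ g)) (e g v)).symm.trans (hα (proj Γ g) v)⟩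

end LeftQuotient

theorem mainTheorem7
    {E : Type*} [NormedAddCommGroup E] [NormedSpace ℝ E] [FiniteDimensional ℝ E]
    {G : Type*} [TopologicalSpace G] [T2Space G] [SecondCountableTopology G] [ConnectedSpace G]
    [ChartedSpace E G] [Group G] [LieGroup 𝓘(ℝ, E) ∞ G] [Group.IsSolvable G]
    (Γ : Subgroup G) [DiscreteTopology Γ] [CompactSpace (LeftQuotient Γ)]
    (n : ℕ) (hn : Module.finrank ℝ E = 4 * n)
    (H : HypercomplexStructure E (LeftQuotient Γ))
    (hH : LeftQuotient.IsInvariantHypercomplex H) :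
    (∀ x : LeftQuotient Γ, holonomyGroup H.obata x ≤ H.SL x) ↔
      ∃ η : ComplexForm E (LeftQuotient Γ) (2 * n),
        η.IsHolomorphic H.I ∧ (∀ x, η x ≠ 0) ∧ LeftQuotient.IsInvariantForm η := by
  obtain ⟨Φ, hΦ⟩ := LeftQuotient.exists_hypercomplexFrame H hH
  have hV : Module.finrank ℝ E = 2 * (2 * n) := by rw [hn]; ring
  have : Nonempty (LeftQuotient Γ) := ⟨LeftQuotient.proj Γ 1⟩
  constructor
  · intro h
    obtain ⟨η, α, h1, h2, h3⟩ :=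
      Φ.exists_isHolomorphic hV (Φ.traceForm_eq_zero_of_holonomyGroup_le h)
    exact ⟨η, h1, h2, (LeftQuotient.isInvariantForm_iff hΦ).2 ⟨α, h3⟩⟩
  · rintro ⟨η, h1, h2, h3⟩ x
    obtain ⟨α, hα⟩ := (LeftQuotient.isInvariantForm_iff hΦ).1 h3
    exact Φ.holonomyGroup_le_SL (Φ.traceForm_eq_zero_of_isHolomorphic hV h1 hα (h2 x)) x
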